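/- **Conventions.** For probability measures $P\ll Q$ and $\alpha\ge 0$ let $H_\alpha(P\|Q)=\int \max\{\frac{dP}{dQ}-\alpha,0\}\,dQ$ (hockey stick divergence). For means $\mu\in\mathbb R^{K}$, weights $p\in[0,1]^{K}$ and $\sigma>0$ let $\mathrm{MoG}(\mu,p,\sigma)=\sum_{k=1}^{K}p_k\,\mathcal N(\mu_k,\sigma^2)$ (standard deviation $\sigma$). For an integer $\lambda\ge 1$ and $r\in[0,1]$ let $\mu=(0,2,4,\dots,2\lambda)$ and $p_i=\mathrm{Binomial}(i-1\mid\lambda,r)=\binom{\lambda}{i-1}r^{i-1}(1-r)^{\lambda-i+1}$ for $i=1,\dots,\lambda+1$, and put $$\overline P_r(\lambda)=\mathrm{MoG}(-\mu,p,\sigma),\qquad \overline Q_r(\lambda)=\mathrm{MoG}(\mu,p,\sigma).$$ **Training epoch.** A dataset is a family $x=(x_1,\dots,x_N)$ of time series $x_n\in\mathbb R^{L}$. Write $x\simeq x'$ if $x$ and $x'$ differ in exactly one series, and that series differs in exactly one time step ($1$-event-level neighbors). Fix a context length $L_C$ and a forecast length $L_F$ with $L-L_F+1\ge L_C+L_F$,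 an integer $\Lambda\ge1$ (batch size), a parametric model $f_\theta$ with $\theta\in\mathbb R^D$, a loss $\mathcal L$, a learning rate $\eta\in\mathbb R$, a clipping norm $C>0$, a noise scale $\sigma>0$ and an initial parameter $\theta_0$. One epoch consists of $\lfloor N\lambda/\Lambda\rfloor$ steps. Step $b=1,2,\dots$ uses the series $x_n$ with $(b-1)\lfloor\Lambda/\lambda\rfloor<n\le b\lfloor\Lambda/\lambda\rfloor$ (deterministic top-level iteration). From each of them, after prepending $L_C$ zeros, $\lambda$ contiguous subsequences of length $L_C+L_F$ are drawn independently and uniformly with replacement from the $L-L_F+1$ available starting positions. Each drawn subsequence, split into its first $L_C$ entries $y_C$ and its last $L_F$ entries $y_F$, contributes the clipped gradient $g/\max\{1,\|g\|_2/C\}$, where $g=\nabla_\theta\mathcal L(f_\theta(y_C),y_F)$ at the current $\theta$ (read as $0$ where the loss is not differentiable in $\theta$). If $\hat g$ is the sum of these contributions (with multiplicity), the step releases $\tilde g=\frac1\Lambda\big(\hat g+\mathcal N(0,\sigma^2C^2I)\big)$ and updates $\theta\leftarrow\theta-\eta\tilde g$. Let $M_x$ be the joint law of all noisy gradients $\tilde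 g$ released during the epoch on dataset $x$. **Theorem.** Let $\lambda\ge1$ and $\sigma>0$. 1. For the epoch mechanism $M$ above, with $r=\frac{L_C+L_F}{L-L_F+1}$, the per-epoch privacy profile $H(\alpha)=\sup_{x\simeq x'}H_\alpha(M_x\|M_{x'})$ satisfies, for all $\alpha\ge0$, $$H(\alpha)\le H_\alpha\big(\overline P_r(\lambda)\,\|\,\overline Q_r(\lambda)\big).$$ 2. (Group substitution for sampling with replacement.) Let $\mathbb A$ be a set, $\Delta>0$, and let $f$ map finite multisets over $\mathbb A$ to $\mathbb R^D$ with $\|f(y\cup\{a\})-f(y)\|_2\le\Delta$ for all multisets $y$ and all $a\in\mathbb A$ (multiset union). For a set $x\subseteq\mathbb A$ with $|x|=T\ge1$ let $M_x$ be the law of $f(y)+\mathcal N(0,\sigma^2\Delta^2I)$, where $y$ is the multiset of $\lambda$ elements drawn independently and uniformly with replacement from $x$. If $x,x'\subseteq\mathbb A$ have size $T$ and there are $g\subseteq x$ and $g'\subseteq x'$ with $|g|=|g'|=k$ and $x\setminus g=x'\setminus g'$, then for all $\alpha\ge0$, with $r=k/T$, $$H_\alpha(M_x\|M_{x'})\le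 H_\alpha\big(\overline P_r(\lambda)\,\|\,\overline Q_r(\lambda)\big).$$ -/

import Mathlib

open MeasureTheory ProbabilityTheory
open scoped ENNReal NNReal

noncomputable section

/-- Hockey stick divergence `H_α(P ‖ Q) = ∫ max (dP/dQ - α, 0) dQ`, for `P` absolutely continuous
with respect to `Q`. It is only used for pairs of nondegenerate Gaussian mixtures and for pairs of
output laws that are mutually absolutely continuous. -/
def hockeyStick {Ω : Type*} [MeasurableSpace Ω] (α : ℝ) (P Q : Measure Ω) : ℝ≥0∞ :=
  ∫⁻ o, ENNReal.ofReal ((P.rnDeriv Q o).toReal - α) ∂Q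

/-- The privacy profile `α ↦ sup_{x ≃ x'} H_α(M_x ‖ M_{x'})` of a mechanism, given by the law `M x`
of its output on each dataset `x`. -/
def privacyProfile {X Ω : Type*} [MeasurableSpace Ω] (nbr : X → X → Prop) (M : X → Measure Ω)
    (α : ℝ) : ℝ≥0∞ :=
  ⨆ (x : X) (x' : X) (_ : nbr x x'), hockeyStick α (M x) (M x')

/-- The univariate Gaussian mixture with means `μ`, weights `p` and standard deviation `σ`. -/
def MoG {K : ℕ} (μ p : Fin K → ℝ) (σ : ℝ≥0) : Measure ℝ :=
  ∑ k, ENNReal.ofReal (p k) • gaussianReal (μ k) (σ ^ 2)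

/-- The means `0, 2, 4, …, 2 * lam`. -/
def evenMeans (lam : ℕ) (i : Fin (lam + 1)) : ℝ := 2 * (i : ℝ)

/-- The probabilities `Binomial(i | lam, r)` for `i = 0, …, lam`. -/
def binomialWeights (lam : ℕ) (r : ℝ) (i : Fin (lam + 1)) : ℝ :=
  (lam.choose i : ℝ) * r ^ (i : ℕ) * (1 - r) ^ (lam - (i : ℕ))

/-- The law of the result of drawing `i` uniformly at random from the finite type `ι` and then
drawing from `κ i`. -/
def uniformMixture {ι Ω : Type*} [Fintype ι] [MeasurableSpace Ω] (κ : ι → Measure Ω) :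
    Measure Ω :=
  (Fintype.card ι : ℝ≥0∞)⁻¹ • ∑ i, κ i

/-- The isotropic Gaussian `N(0, s² I)` on `ℝ^D`. -/
def isotropicGaussian (D : ℕ) (s : ℝ≥0) : Measure (EuclideanSpace ℝ (Fin D)) :=
  (stdGaussian (EuclideanSpace ℝ (Fin D))).map (fun z => (s : ℝ) • z)

/-- Two datasets of `N` time series of length `L` are `w`-event-level neighboring if they differ in
exactly one series, and there only inside a window of `w` consecutive time steps. -/
def EventNeighbor {N L : ℕ} (w : ℕ) (x x' : Fin N → Fin L → ℝ) : Prop :=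
  ∃ n, (∀ m, m ≠ n → x m = x' m) ∧ x n ≠ x' n ∧
    ∃ t : Fin L, ∀ s : Fin L, ¬ ((t : ℕ) ≤ s ∧ (s : ℕ) < t + w) → x n s = x' n s

/-- The series `a` with `LC` zeros prepended, as a sequence indexed from `0`
(positions `LC + L` and later, which no subsequence reaches, also carry `0`). -/
def prependZeros {L : ℕ} (LC : ℕ) (a : Fin L → ℝ) (j : ℕ) : ℝ :=
  if h : LC ≤ j ∧ j - LC < L then a ⟨j - LC, h.2⟩ else 0

/-- The context window of the subsequence of length `LC + LF` that starts at position `t` of the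
zero-padded series. -/
def contextWindow {L : ℕ} (LC : ℕ) (a : Fin L → ℝ) (t : ℕ) : Fin LC → ℝ :=
  fun i => prependZeros LC a (t + i)

/-- The forecast window of the subsequence of length `LC + LF` that starts at position `t` of the
zero-padded series. -/
def forecastWindow {L : ℕ} (LC LF : ℕ) (a : Fin L → ℝ) (t : ℕ) : Fin LF → ℝ :=
  fun i => prependZeros LC a (t + LC + i)

/-- Gradient clipping: `g / max {1, ‖g‖ / C}`. -/
def clipGradient {D : ℕ} (C : ℝ≥0) (g : EuclideanSpace ℝ (Fin D)) : EuclideanSpace ℝ (Fin D) :=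
  (max 1 (‖g‖ / C))⁻¹ • g

/-- The clipped gradient, with respect to the parameters, of the loss on the subsequence of the
series `a` that starts at position `t`. -/
def windowGradient {L LC LF D : ℕ} {O : Type*}
    (model : EuclideanSpace ℝ (Fin D) → (Fin LC → ℝ) → O) (loss : O → (Fin LF → ℝ) → ℝ)
    (C : ℝ≥0) (θ : EuclideanSpace ℝ (Fin D)) (a : Fin L → ℝ) (t : ℕ) :
    EuclideanSpace ℝ (Fin D) :=
  clipGradient C
    (gradient (fun ϑ => loss (model ϑ (contextWindow LC a t)) (forecastWindow LC LF a t)) θ)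

/-- Deterministic top-level iteration: the indices of the series used in batch number `b`
(counted from `0`), a block of `⌊Lam / lam⌋` consecutive indices. -/
def topLevelBatch (N lam Lam b : ℕ) : Finset (Fin N) :=
  Finset.univ.filter fun n => b * (Lam / lam) ≤ (n : ℕ) ∧ (n : ℕ) < (b + 1) * (Lam / lam)

/-- The law of the noisy gradient `(1 / Lam) * (ĝ + N(0, σ² C² I))` computed in training step `b`
from parameters `θ`. For every series of the batch, `lam` starting positions are drawn
independently and uniformly, with replacement, from the `L - LF + 1` possible ones, and `ĝ` is the
sum of the clipped gradients of all drawn subsequences, counted with multiplicity. -/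
def noisyGradientLaw {N L LC LF D : ℕ} {O : Type*} (lam Lam : ℕ)
    (model : EuclideanSpace ℝ (Fin D) → (Fin LC → ℝ) → O) (loss : O → (Fin LF → ℝ) → ℝ)
    (σ C : ℝ≥0) (x : Fin N → Fin L → ℝ) (b : ℕ) (θ : EuclideanSpace ℝ (Fin D)) :
    Measure (EuclideanSpace ℝ (Fin D)) :=
  uniformMixture fun start : topLevelBatch N lam Lam b → Fin lam → Fin (L - LF + 1) =>
    (isotropicGaussian D (σ * C)).map fun z =>
      (Lam : ℝ)⁻¹ • ((∑ n : topLevelBatch N lam Lam b, ∑ j,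
        windowGradient model loss C θ (x n) (start n j)) + z)

/-- The joint law of the noisy gradients `g̃_0, …, g̃_{k-1}` released in the first `k` training
steps. Step `k` uses the parameters `θ₀ - η * (g̃_0 + ⋯ + g̃_{k-1})` that result from the
preceding updates `θ ← θ - η * g̃`. -/
def trainingLaw {N L LC LF D : ℕ} {O : Type*} (lam Lam : ℕ)
    (model : EuclideanSpace ℝ (Fin D) → (Fin LC → ℝ) → O) (loss : O → (Fin LF → ℝ) → ℝ)
    (η : ℝ) (σ C : ℝ≥0) (θ₀ : EuclideanSpace ℝ (Fin D)) (x : Fin N → Fin L → ℝ) :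
    (k : ℕ) → Measure (Fin k → EuclideanSpace ℝ (Fin D))
  | 0 => Measure.dirac Fin.elim0
  | k + 1 => (trainingLaw lam Lam model loss η σ C θ₀ x k).bind fun h =>
      (noisyGradientLaw lam Lam model loss σ C x k (θ₀ - η • ∑ i, h i)).map fun g =>
        Fin.snoc (α := fun _ => EuclideanSpace ℝ (Fin D)) h g

/-- The mechanism of one epoch, which consists of `⌊N * lam / Lam⌋` training steps and releases the
noisy gradient of each of them. -/
def epochMechanism {N L LC LF D : ℕ} {O : Type*} (lam Lam : ℕ)
    (model : EuclideanSpace ℝ (Fin D) → (Fin LC → ℝ) → O) (loss : O → (Fin LF → ℝ) → ℝ)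
    (η : ℝ) (σ C : ℝ≥0) (θ₀ : EuclideanSpace ℝ (Fin D)) (x : Fin N → Fin L → ℝ) :
    Measure (Fin (N * lam / Lam) → EuclideanSpace ℝ (Fin D)) :=
  trainingLaw lam Lam model loss η σ C θ₀ x (N * lam / Lam)

/-- `k`-group-substitution neighbors: after removal of a group of `k` elements from each, the two
sets coincide. -/
def GroupSubstitutionNeighbor {A : Type*} [DecidableEq A] (k : ℕ) (x x' : Finset A) : Prop :=
  ∃ g g' : Finset A, g ⊆ x ∧ g' ⊆ x' ∧ g.card = k ∧ g'.card = k ∧ x \ g = x' \ g'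

/-- `f` has `ℓ₂`-sensitivity at most `Δ` under insertion or removal of one batch element. -/
def SensitivityBound {A : Type*} {D : ℕ} (f : Multiset A → EuclideanSpace ℝ (Fin D))
    (Δ : ℝ≥0) : Prop :=
  ∀ (y : Multiset A) (a : A), ‖f (a ::ₘ y) - f y‖ ≤ Δ

/-- The Gaussian mechanism `y ↦ f y + N(0, σ² Δ² I)` applied to a multiset `y` of `lam` elements
drawn independently and uniformly, with replacement, from the set `x`. -/
def withReplacementMechanism {A : Type*} {D : ℕ} (lam : ℕ)
    (f : Multiset A → EuclideanSpace ℝ (Fin D)) (σ Δ : ℝ≥0) (x : Finset A) :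
    Measure (EuclideanSpace ℝ (Fin D)) :=
  uniformMixture fun draw : Fin lam → x =>
    (isotropicGaussian D (σ * Δ)).map fun z =>
      f ((Finset.univ : Finset (Fin lam)).val.map fun j => (draw j : A)) + z

end

/-!
A bound on the hockey stick divergence amounts to an inequality between the powers of every
randomized test under the two laws, and in this form it survives post-processing, mixing and
adaptive composition.

A draw with replacement first decides, with probability `r`, whether to hit the group of changed
elements, and then picks an element inside or outside of the group. Picking both elements beforehand
and conditioning on them, only the random set `S` of draws that hit the group is left. Both laws are
then mixtures over `S`, with the same weights, of spherical Gaussians whose centers lie within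
`2 * #S * Δ` of the common center that belongs to `S = ∅`. By the Neyman–Pearson lemma, moving the
center by at most a given distance changes the power of a test no more than it changes the Gaussian
measure of a half-line of the same size. As the size of a test only refers to the common center, one
half-line serves all components of both mixtures, which reduces them to `P̄_r` and `Q̄_r`.

In a training epoch only one step uses the changed series, and each of its draws contains a changed
entry with probability at most `r`.
-/

section HockeyStick

variable {Ω Ω' : Type*} [MeasurableSpace Ω] [MeasurableSpace Ω']

/-- A randomized test: `φ o` is the probability with which the outcome `o` is rejected. -/
structure IsTest (φ : Ω → ℝ≥0∞) : Prop where
  measurable : Measurable φ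
  le_one : ∀ o, φ o ≤ 1

namespace IsTest

variable {φ : Ω → ℝ≥0∞}

theorem indicator_one {S : Set Ω} (hS : MeasurableSet S) : IsTest (S.indicator (1 : Ω → ℝ≥0∞)) where
  measurable := measurable_one.indicator hS
  le_one := Set.indicator_le_self S 1

theorem one_sub (hφ : IsTest φ) : IsTest fun o => 1 - φ o where
  measurable := measurable_const.sub hφ.measurable
  le_one _ := tsub_le_self

theorem comp (hφ : IsTest φ) {g : Ω' → Ω} (hg : Measurable g) : IsTest fun o => φ (g o) where
  measurable := hφ.measurable.comp hg
  le_one _ := hφ.le_one _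

theorem lintegral_le_one (hφ : IsTest φ) (P : Measure Ω) [IsProbabilityMeasure P] :
    ∫⁻ o, φ o ∂P ≤ 1 :=
  (lintegral_mono hφ.le_one).trans (by simp)

theorem lintegral_kernel (hφ : IsTest φ) (κ : Kernel Ω' Ω) [IsMarkovKernel κ] :
    IsTest fun o' => ∫⁻ o, φ o ∂κ o' where
  measurable := hφ.measurable.lintegral_kernel
  le_one o' := hφ.lintegral_le_one (κ o')

theorem lintegral_one_sub (hφ : IsTest φ) (P : Measure Ω) [IsProbabilityMeasure P] :
    ∫⁻ o, (1 - φ o) ∂P = 1 - ∫⁻ o, φ o ∂P := by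
  rw [lintegral_sub hφ.measurable
    (ne_top_of_le_ne_top ENNReal.one_ne_top (hφ.lintegral_le_one P)) (ae_of_all _ hφ.le_one)]
  simp

theorem lintegral_add_lintegral_one_sub (hφ : IsTest φ) (μ : Measure Ω) :
    ∫⁻ o, φ o ∂μ + ∫⁻ o, (1 - φ o) ∂μ = μ Set.univ := by
  rw [← lintegral_add_left hφ.measurable, ← setLIntegral_one, Measure.restrict_univ]
  exact lintegral_congr fun o => add_tsub_cancel_of_le (hφ.le_one o)

end IsTest

/-- `(a, δ)`-indistinguishability, in one direction: the power of every test under `P` is at most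
`a` times its power under `Q`, plus `δ`. For `P ≪ Q` and `a = ofReal α`, the least such `δ` is the
hockey stick divergence `hockeyStick α P Q`. -/
def ApproxLE (a δ : ℝ≥0∞) (P Q : Measure Ω) : Prop :=
  ∀ φ : Ω → ℝ≥0∞, IsTest φ → ∫⁻ o, φ o ∂P ≤ a * ∫⁻ o, φ o ∂Q + δ

theorem setLIntegral_sub_rnDeriv_eq_hockeyStick (α : ℝ) (P Q : Measure Ω) :
    ∫⁻ o in {o | α < (P.rnDeriv Q o).toReal}, ENNReal.ofReal ((P.rnDeriv Q o).toReal - α) ∂Q =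
      hockeyStick α P Q := by
  refine setLIntegral_eq_of_support_subset fun o ho => ?_
  rw [Function.mem_support, ENNReal.ofReal_ne_zero_iff, sub_pos] at ho
  exact ho

theorem approxLE_hockeyStick {P Q : Measure Ω} [SigmaFinite P] [SigmaFinite Q] (hPQ : P ≪ Q)
    (α : ℝ) : ApproxLE (ENNReal.ofReal α) (hockeyStick α P Q) P Q := by
  intro φ hφ
  have hm : Measurable fun o => ENNReal.ofReal α * φ o := hφ.measurable.const_mul _
  rw [← lintegral_rnDeriv_mul hPQ hφ.measurable.aemeasurable, ← lintegral_const_mul _ hφ.measurable,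
    hockeyStick, ← lintegral_add_left hm]
  refine lintegral_mono_ae ?_
  filter_upwards [P.rnDeriv_lt_top Q] with o ho
  calc P.rnDeriv Q o * φ o
      ≤ (ENNReal.ofReal α + ENNReal.ofReal ((P.rnDeriv Q o).toReal - α)) * φ o := by
        gcongr
        rw [← ENNReal.ofReal_toReal ho.ne, ENNReal.toReal_ofReal ENNReal.toReal_nonneg]
        refine le_trans ?_ ENNReal.ofReal_add_le
        rw [add_sub_cancel]
    _ ≤ ENNReal.ofReal α * φ o + ENNReal.ofReal ((P.rnDeriv Q o).toReal - α) := by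
        rw [add_mul]
        gcongr
        exact mul_le_of_le_one_right' (hφ.le_one o)

namespace ApproxLE

variable {a δ : ℝ≥0∞} {P Q : Measure Ω}

theorem measure_le (h : ApproxLE a δ P Q) {S : Set Ω} (hS : MeasurableSet S) :
    P S ≤ a * Q S + δ := by
  simpa only [lintegral_indicator_one hS] using h _ (IsTest.indicator_one hS)

theorem hockeyStick_le {α : ℝ} [IsFiniteMeasure Q] (hα : 0 ≤ α)
    (h : ApproxLE (ENNReal.ofReal α) δ P Q) : hockeyStick α P Q ≤ δ := by
  let S : Set Ω := {o | α < (P.rnDeriv Q o).toReal}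
  have hS : MeasurableSet S :=
    measurableSet_lt measurable_const (P.measurable_rnDeriv Q).ennreal_toReal
  have hfin : ENNReal.ofReal α * Q S ≠ ∞ :=
    ENNReal.mul_ne_top ENNReal.ofReal_ne_top (measure_ne_top _ _)
  refine (ENNReal.add_le_add_iff_left hfin).1 ?_
  calc ENNReal.ofReal α * Q S + hockeyStick α P Q
      = ∫⁻ o in S, (ENNReal.ofReal α + ENNReal.ofReal ((P.rnDeriv Q o).toReal - α)) ∂Q := by
        rw [lintegral_add_left measurable_const, setLIntegral_const,
          setLIntegral_sub_rnDeriv_eq_hockeyStick]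
    _ ≤ ∫⁻ o in S, P.rnDeriv Q o ∂Q := by
        refine setLIntegral_mono (P.measurable_rnDeriv Q) fun o ho => ?_
        rw [← ENNReal.ofReal_add hα (sub_pos.2 ho).le, add_sub_cancel]
        exact ENNReal.ofReal_toReal_le
    _ ≤ P S := Measure.setLIntegral_rnDeriv_le S
    _ ≤ ENNReal.ofReal α * Q S + δ := h.measure_le hS

theorem refl (P : Measure Ω) [IsProbabilityMeasure P] (h : 1 ≤ a + δ) : ApproxLE a δ P P := by
  intro φ hφ
  calc ∫⁻ o, φ o ∂P ≤ (a + δ) * ∫⁻ o, φ o ∂P := le_mul_of_one_le_left' h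
    _ ≤ a * ∫⁻ o, φ o ∂P + δ := by
        rw [add_mul]
        gcongr
        exact mul_le_of_le_one_right' (hφ.lintegral_le_one P)

theorem map (h : ApproxLE a δ P Q) {g : Ω → Ω'} (hg : Measurable g) :
    ApproxLE a δ (P.map g) (Q.map g) := by
  intro φ hφ
  rw [lintegral_map hφ.measurable hg, lintegral_map hφ.measurable hg]
  exact h _ (hφ.comp hg)

theorem bind_right (h : ApproxLE a δ P Q) (κ : Kernel Ω Ω') [IsMarkovKernel κ] :
    ApproxLE a δ (P.bind κ) (Q.bind κ) := by
  intro φ hφ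
  rw [Measure.lintegral_bind κ.aemeasurable hφ.measurable.aemeasurable,
    Measure.lintegral_bind κ.aemeasurable hφ.measurable.aemeasurable]
  exact h _ (hφ.lintegral_kernel κ)

theorem bind (P : Measure Ω) [IsProbabilityMeasure P] {κ η : Kernel Ω Ω'}
    (h : ∀ o, ApproxLE a δ (κ o) (η o)) : ApproxLE a δ (P.bind κ) (P.bind η) := by
  intro φ hφ
  rw [Measure.lintegral_bind κ.aemeasurable hφ.measurable.aemeasurable,
    Measure.lintegral_bind η.aemeasurable hφ.measurable.aemeasurable]
  calc ∫⁻ o, ∫⁻ y, φ y ∂κ o ∂P ≤ ∫⁻ o, (a * ∫⁻ y, φ y ∂η o + δ) ∂P :=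
        lintegral_mono fun o => h o φ hφ
    _ = a * ∫⁻ o, ∫⁻ y, φ y ∂η o ∂P + δ := by
        have hm : Measurable fun o => ∫⁻ y, φ y ∂η o := hφ.measurable.lintegral_kernel
        rw [lintegral_add_right _ measurable_const, lintegral_const_mul _ hm]
        simp

theorem sum_smul {ι : Type*} [Fintype ι] {w : ι → ℝ≥0∞} {P Q : ι → Measure Ω}
    (hw : ∑ i, w i = 1) (h : ∀ i, w i ≠ 0 → ApproxLE a δ (P i) (Q i)) :
    ApproxLE a δ (∑ i, w i • P i) (∑ i, w i • Q i) := by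
  intro φ hφ
  simp only [lintegral_finsetSum_measure, lintegral_smul_measure, smul_eq_mul]
  calc ∑ i, w i * ∫⁻ o, φ o ∂P i ≤ ∑ i, w i * (a * ∫⁻ o, φ o ∂Q i + δ) := by
        refine Finset.sum_le_sum fun i _ => ?_
        rcases eq_or_ne (w i) 0 with hi | hi
        · simp only [hi, zero_mul, le_refl]
        · gcongr
          exact h i hi φ hφ
    _ = a * ∑ i, w i * ∫⁻ o, φ o ∂Q i + δ := by
        simp only [mul_add, Finset.sum_add_distrib, ← Finset.sum_mul, hw, one_mul,
          Finset.mul_sum, mul_left_comm a]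

end ApproxLE

end HockeyStick

section UniformMixture

variable {ι κ Ω Ω' : Type*} [Fintype ι] [Fintype κ] [MeasurableSpace Ω] [MeasurableSpace Ω']

theorem isProbabilityMeasure_uniformMixture [Nonempty ι] {μ : ι → Measure Ω}
    (hμ : ∀ i, IsProbabilityMeasure (μ i)) : IsProbabilityMeasure (uniformMixture μ) where
  measure_univ := by
    simp [uniformMixture, ENNReal.inv_mul_cancel]

theorem uniformMixture_comp_equiv (e : ι ≃ κ) (μ : κ → Measure Ω) :
    (uniformMixture fun i => μ (e i)) = uniformMixture μ := by
  rw [uniformMixture, uniformMixture, Fintype.card_congr e, e.sum_comp μ]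

theorem uniformMixture_prod (μ : ι × κ → Measure Ω) :
    uniformMixture μ = uniformMixture fun k => uniformMixture fun i => μ (i, k) := by
  simp only [uniformMixture]
  rw [Fintype.card_prod, Nat.cast_mul, ENNReal.mul_inv (Or.inr (ENNReal.natCast_ne_top _))
    (Or.inl (ENNReal.natCast_ne_top _)), Fintype.sum_prod_type_right, ← Finset.smul_sum, smul_smul,
    mul_comm]

theorem uniformMixture_pi {B : Type*} [Fintype B] [DecidableEq B] (b : B)
    (μ : (B → κ) → Measure Ω) :
    uniformMixture μ = uniformMixture fun ρ : {j // j ≠ b} → κ =>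
      uniformMixture fun k => μ ((Equiv.funSplitAt b κ).symm (k, ρ)) := by
  rw [← uniformMixture_comp_equiv (Equiv.funSplitAt b κ).symm μ, uniformMixture_prod]

theorem map_uniformMixture (μ : ι → Measure Ω) {g : Ω → Ω'} (hg : Measurable g) :
    (uniformMixture μ).map g = uniformMixture fun i => (μ i).map g := by
  simp only [uniformMixture, Measure.map_smul, Measure.map_finset_sum' hg.aemeasurable]

theorem measurable_uniformMixture {μ : ι → Ω' → Measure Ω} (hμ : ∀ i, Measurable (μ i)) :
    Measurable fun o => uniformMixture fun i => μ i o := by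
  refine Measure.measurable_of_measurable_coe _ fun S hS => ?_
  simp only [uniformMixture, Measure.smul_apply, Measure.coe_finsetSum, Finset.sum_apply,
    smul_eq_mul]
  exact (Finset.measurable_sum _ fun i _ => (Measure.measurable_coe hS).comp (hμ i)).const_mul _

theorem ApproxLE.uniformMixture [Nonempty ι] {a δ : ℝ≥0∞} {μ ν : ι → Measure Ω}
    (h : ∀ i, ApproxLE a δ (μ i) (ν i)) :
    ApproxLE a δ (uniformMixture μ) (uniformMixture ν) := by
  simp only [_root_.uniformMixture, Finset.smul_sum]
  exact ApproxLE.sum_smul (by simp [ENNReal.mul_inv_cancel]) fun i _ => h i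

end UniformMixture

section GaussianLine

open Filter Topology

theorem neyman_pearson {Ω : Type*} [MeasurableSpace Ω] {μ : Measure Ω} [IsFiniteMeasure μ]
    {L : Ω → ℝ≥0∞} (hL : Measurable L) {A : Set Ω} (hA : MeasurableSet A) {t : ℝ≥0∞}
    (htL : ∀ o ∈ A, t ≤ L o) (hLt : ∀ o ∉ A, L o ≤ t) {φ : Ω → ℝ≥0∞} (hφ : IsTest φ)
    (h : ∫⁻ o, φ o ∂μ ≤ μ A) :
    ∫⁻ o, φ o ∂μ.withDensity L ≤ μ.withDensity L A := by
  have hsplit : ∀ ν : Measure Ω, ν A = ∫⁻ o in A, φ o ∂ν + ∫⁻ o in A, (1 - φ o) ∂ν := fun ν => by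
    rw [hφ.lintegral_add_lintegral_one_sub, Measure.restrict_apply_univ]
  have hfin : ∫⁻ o in A, φ o ∂μ ≠ ∞ :=
    ne_top_of_le_ne_top (measure_ne_top μ A) ((hsplit μ).symm ▸ le_self_add)
  have hcompl : ∫⁻ o in Aᶜ, φ o ∂μ ≤ ∫⁻ o in A, (1 - φ o) ∂μ := by
    rwa [← lintegral_add_compl _ hA, hsplit, ENNReal.add_le_add_iff_left hfin] at h
  rw [← lintegral_add_compl _ hA, hsplit]
  refine add_le_add le_rfl ?_
  have hwith : ∀ {ψ : Ω → ℝ≥0∞}, IsTest ψ → ∀ {S : Set Ω}, MeasurableSet S →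
      ∫⁻ o in S, ψ o ∂μ.withDensity L = ∫⁻ o in S, L o * ψ o ∂μ := fun hψ S hS => by
    rw [restrict_withDensity hS, lintegral_withDensity_eq_lintegral_mul _ hL hψ.measurable]
    rfl
  calc ∫⁻ o in Aᶜ, φ o ∂μ.withDensity L
      ≤ ∫⁻ o in Aᶜ, t * φ o ∂μ := by
        rw [hwith hφ hA.compl]
        exact setLIntegral_mono' hA.compl fun o ho => by gcongr; exact hLt o ho
    _ ≤ t * ∫⁻ o in A, (1 - φ o) ∂μ := by
        rw [lintegral_const_mul _ hφ.measurable]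
        gcongr
    _ ≤ ∫⁻ o in A, (1 - φ o) ∂μ.withDensity L := by
        rw [hwith hφ.one_sub hA, ← lintegral_const_mul _ hφ.one_sub.measurable]
        exact setLIntegral_mono' hA fun o ho => by gcongr; exact htL o ho

theorem IsTest.lintegral_withDensity_le_of_antitone {μ : Measure ℝ} [IsFiniteMeasure μ]
    {φ : ℝ → ℝ≥0∞} (hφ : IsTest φ) {L : ℝ → ℝ≥0∞} (hL : Antitone L) {A : Set ℝ}
    (hA : IsLowerSet A) (h : ∫⁻ x, φ x ∂μ ≤ μ A) :
    ∫⁻ x, φ x ∂μ.withDensity L ≤ μ.withDensity L A := by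
  refine neyman_pearson hL.measurable hA.ordConnected.measurableSet (t := ⨆ y ∈ Aᶜ, L y)
    (fun x hx => iSup₂_le fun y hy => hL ?_) (fun y hy => le_iSup₂_of_le y hy le_rfl) hφ h
  exact (le_total x y).resolve_right fun hyx => hy (hA hyx hx)

theorem gaussianReal_eq_withDensity (c : ℝ) {v : ℝ≥0} (hv : v ≠ 0) :
    gaussianReal c v = (gaussianReal 0 v).withDensity fun x =>
      ENNReal.ofReal (Real.exp ((2 * c * x - c ^ 2) / (2 * v))) := by
  rw [gaussianReal_of_var_ne_zero c hv, gaussianReal_of_var_ne_zero 0 hv,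
    ← withDensity_mul _ (measurable_gaussianPDF 0 v) (by fun_prop)]
  congr with x
  rw [Pi.mul_apply, gaussianPDF, gaussianPDF, ← ENNReal.ofReal_mul (gaussianPDFReal_nonneg 0 v x),
    gaussianPDFReal, gaussianPDFReal, mul_assoc (_)⁻¹, ← Real.exp_add]
  congr 3
  ring

theorem IsTest.lintegral_gaussianReal_le {φ : ℝ → ℝ≥0∞} (hφ : IsTest φ) {v : ℝ≥0} (hv : v ≠ 0)
    {c : ℝ} (hc : c ≤ 0) {A : Set ℝ} (hA : IsLowerSet A)
    (h : ∫⁻ x, φ x ∂gaussianReal 0 v ≤ gaussianReal 0 v A) :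
    ∫⁻ x, φ x ∂gaussianReal c v ≤ gaussianReal c v A := by
  rw [gaussianReal_eq_withDensity c hv]
  refine hφ.lintegral_withDensity_le_of_antitone (fun x y hxy => ?_) hA h
  have := mul_le_mul_of_nonpos_left hxy hc
  gcongr ENNReal.ofReal (Real.exp (?_ / _))
  linarith

theorem gaussianReal_anti_of_isLowerSet {A : Set ℝ} (hA : IsLowerSet A) (v : ℝ≥0) :
    Antitone fun c => gaussianReal c v A := by
  intro b c hbc
  have hb : gaussianReal b v = (gaussianReal c v).map (· + (b - c)) := by
    rw [gaussianReal_map_add_const, add_sub_cancel]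
  simp only [hb]
  rw [Measure.map_apply (by fun_prop) hA.ordConnected.measurableSet]
  exact measure_mono fun x hx => hA (by linarith) hx

theorem gaussianReal_neg_preimage_compl (c : ℝ) (v : ℝ≥0) {A : Set ℝ} (hA : MeasurableSet A) :
    gaussianReal (-c) v ((- ·) ⁻¹' Aᶜ) = 1 - gaussianReal c v A := by
  rw [← prob_compl_eq_one_sub hA, ← Measure.map_apply measurable_neg hA.compl,
    gaussianReal_map_neg, neg_neg]

theorem gaussianReal_zero_one_map_add_mul (c : ℝ) (s : ℝ≥0) :
    (gaussianReal 0 1).map (fun x => c + s * x) = gaussianReal c (s ^ 2) := by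
  have h := Measure.map_map (μ := gaussianReal 0 1) (measurable_const_add c)
    (measurable_const_mul (s : ℝ))
  rw [gaussianReal_map_const_mul, gaussianReal_map_const_add, mul_zero, zero_add, mul_one] at h
  exact h.symm

theorem continuous_measureReal_Iic_gaussianReal (c : ℝ) {v : ℝ≥0} (hv : v ≠ 0) :
    Continuous fun t => (gaussianReal c v).real (Set.Iic t) := by
  have hint := integrable_gaussianPDFReal c v
  have hreal : ∀ t, (gaussianReal c v).real (Set.Iic t) =
      ∫ x in Set.Iic t, gaussianPDFReal c v x := fun t => by
    rw [measureReal_def, gaussianReal_apply_eq_integral _ hv, ENNReal.toReal_ofReal]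
    exact integral_nonneg fun x => gaussianPDFReal_nonneg _ _ _
  have hprim : ∀ t, (gaussianReal c v).real (Set.Iic t) =
      (∫ x in Set.Iic (0 : ℝ), gaussianPDFReal c v x) + ∫ x in (0 : ℝ)..t, gaussianPDFReal c v x :=
    fun t => by
      rw [hreal, ← intervalIntegral.integral_Iic_sub_Iic hint.integrableOn hint.integrableOn,
        add_sub_cancel]
  simp only [hprim]
  exact continuous_const.add
    (intervalIntegral.continuous_primitive (fun _ _ => hint.intervalIntegrable) 0)

theorem exists_isLowerSet_gaussianReal_eq (c : ℝ) {v : ℝ≥0} (hv : v ≠ 0) {p : ℝ≥0∞} (hp : p ≤ 1) :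
    ∃ A : Set ℝ, IsLowerSet A ∧ gaussianReal c v A = p := by
  rcases eq_or_ne p 0 with rfl | hp0
  · exact ⟨∅, isLowerSet_empty, measure_empty⟩
  rcases hp.eq_or_lt with rfl | hp1
  · exact ⟨Set.univ, isLowerSet_univ, measure_univ⟩
  have hbot : Tendsto (fun t => (gaussianReal c v).real (Set.Iic t)) atBot (𝓝 0) := by
    simpa only [← cdf_eq_real] using tendsto_cdf_atBot (gaussianReal c v)
  have htop : Tendsto (fun t => (gaussianReal c v).real (Set.Iic t)) atTop (𝓝 1) := by
    simpa only [← cdf_eq_real] using tendsto_cdf_atTop (gaussianReal c v)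
  have hpt : p ≠ ∞ := ne_top_of_lt hp1
  have hp1' : p.toReal < 1 := ENNReal.toReal_lt_of_lt_ofReal (by simpa using hp1)
  obtain ⟨t, ht⟩ := mem_range_of_exists_le_of_exists_ge
    (continuous_measureReal_Iic_gaussianReal c hv)
    ((hbot.eventually_le_const (ENNReal.toReal_pos hp0 hpt)).exists)
    ((htop.eventually_const_le hp1').exists)
  exact ⟨Set.Iic t, isLowerSet_Iic t,
    (ENNReal.toReal_eq_toReal_iff' (measure_ne_top _ _) hpt).1 ht⟩

end GaussianLine

section SphericalGaussian

theorem norm_sub_inner_smul_sq {E : Type*} [NormedAddCommGroup E]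
    [InnerProductSpace ℝ E] {e : E} (he : ‖e‖ = 1) (t : E) :
    ‖t - inner ℝ e t • e‖ ^ 2 = ‖t‖ ^ 2 - inner ℝ e t ^ 2 := by
  rw [norm_sub_sq_real, real_inner_smul_right, norm_smul, he, mul_one, Real.norm_eq_abs, sq_abs,
    real_inner_comm]
  ring

variable {E : Type*} [NormedAddCommGroup E] [InnerProductSpace ℝ E] [FiniteDimensional ℝ E]
  [MeasurableSpace E] [BorelSpace E]

theorem stdGaussian_eq_map_prod {e : E} (he : ‖e‖ = 1) :
    stdGaussian E = ((gaussianReal 0 1).prod (stdGaussian E)).map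
      fun p : ℝ × E => p.1 • e + (p.2 - inner ℝ e p.2 • e) := by
  have hm : Measurable fun p : ℝ × E => p.1 • e + (p.2 - inner ℝ e p.2 • e) := by fun_prop
  have := Measure.isProbabilityMeasure_map (μ := (gaussianReal 0 1).prod (stdGaussian E))
    hm.aemeasurable
  refine Measure.ext_of_charFun (funext fun t => ?_)
  have hcharFun : charFun (((gaussianReal 0 1).prod (stdGaussian E)).map
      fun p : ℝ × E => p.1 • e + (p.2 - inner ℝ e p.2 • e)) t =
      charFun (gaussianReal 0 1) (inner ℝ e t) *
        charFun (stdGaussian E) (t - inner ℝ e t • e) := by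
    simp only [charFun_apply]
    rw [integral_map hm.aemeasurable (by fun_prop), ← integral_prod_mul]
    refine integral_congr_ae (ae_of_all _ fun p => ?_)
    simp only [← Complex.exp_add, ← add_mul, ← Complex.ofReal_add, inner_add_left, inner_sub_left,
      inner_sub_right, real_inner_smul_left, real_inner_smul_right, RCLike.inner_apply,
      conj_trivial, real_inner_comm p.2 e]
    congr 3
    ring
  rw [hcharFun, charFun_stdGaussian, charFun_stdGaussian, charFun_gaussianReal, ← Complex.exp_add]
  have hnorm : (‖t - inner ℝ e t • e‖ : ℂ) ^ 2 = (‖t‖ : ℂ) ^ 2 - ((inner ℝ e t : ℝ) : ℂ) ^ 2 := by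
    exact_mod_cast norm_sub_inner_smul_sq he t
  rw [hnorm]
  push_cast
  ring_nf

/-- The spherical Gaussian `N(u, s² I)` on a Euclidean space, with `s` the standard deviation. -/
noncomputable def sphericalGaussian (s : ℝ≥0) (u : E) : Measure E :=
  (stdGaussian E).map fun z => u + (s : ℝ) • z

instance isProbabilityMeasure_sphericalGaussian (s : ℝ≥0) (u : E) :
    IsProbabilityMeasure (sphericalGaussian s u) :=
  Measure.isProbabilityMeasure_map (by fun_prop)

theorem measurable_sphericalGaussian (s : ℝ≥0) : Measurable (sphericalGaussian (E := E) s) := by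
  have hg : Measurable fun p : E × E => p.1 + (s : ℝ) • p.2 := by fun_prop
  have hmap : sphericalGaussian (E := E) s = fun u =>
      ((stdGaussian E).map (Prod.mk u)).map fun p : E × E => p.1 + (s : ℝ) • p.2 :=
    funext fun u => (Measure.map_map hg measurable_prodMk_left).symm
  rw [hmap]
  exact (Measure.measurable_map _ hg).comp Measurable.map_prodMk_left

theorem sphericalGaussian_map_add_smul (s c : ℝ≥0) (u m : E) :
    (sphericalGaussian s u).map (fun z => m + (c : ℝ) • z) =
      sphericalGaussian (s * c) (m + (c : ℝ) • u) := by
  rw [sphericalGaussian, sphericalGaussian, Measure.map_map (by fun_prop) (by fun_prop)]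
  congr 1 with z
  simp only [Function.comp_apply, NNReal.coe_mul, smul_add, smul_smul, add_assoc, mul_comm]

theorem isotropicGaussian_map_add (D : ℕ) (s : ℝ≥0) (u : EuclideanSpace ℝ (Fin D)) :
    (isotropicGaussian D s).map (fun z => u + z) = sphericalGaussian s u :=
  Measure.map_map (by fun_prop) (by fun_prop)

-- Integrating the test over the hyperplane orthogonal to `e` reduces it to a test on the line.
theorem IsTest.exists_lintegral_sphericalGaussian_eq {φ : E → ℝ≥0∞} (hφ : IsTest φ) {e : E}
    (he : ‖e‖ = 1) (s : ℝ≥0) :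
    ∃ ψ : ℝ → ℝ≥0∞, IsTest ψ ∧
      ∀ c : ℝ, ∫⁻ z, φ z ∂sphericalGaussian s (c • e) = ∫⁻ x, ψ x ∂gaussianReal c (s ^ 2) := by
  let g : ℝ → E → E := fun x z => x • e + (s : ℝ) • (z - inner ℝ e z • e)
  have hg : Measurable (Function.uncurry g) := by unfold g; fun_prop
  have hφg : IsTest fun p : ℝ × E => φ (g p.1 p.2) := hφ.comp hg
  have hψ : IsTest fun x => ∫⁻ z, φ (g x z) ∂stdGaussian E :=
    ⟨hφg.measurable.lintegral_prod_right',
      fun x => (hφ.comp hg.of_uncurry_left).lintegral_le_one _⟩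
  refine ⟨_, hψ, fun c => ?_⟩
  have hφc : Measurable fun p : ℝ × E => φ (g (c + s * p.1) p.2) :=
    hφg.measurable.comp (by fun_prop : Measurable fun p : ℝ × E => (c + s * p.1, p.2))
  rw [← gaussianReal_zero_one_map_add_mul c s, lintegral_map hψ.measurable (by fun_prop),
    sphericalGaussian, lintegral_map hφ.measurable (by fun_prop)]
  conv_lhs => rw [stdGaussian_eq_map_prod he]
  rw [lintegral_map (f := fun z => φ (c • e + (s : ℝ) • z)) (hφ.measurable.comp (by fun_prop))
    (by fun_prop), ← lintegral_prod _ hφc.aemeasurable]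
  simp only [g, add_smul, smul_add, smul_smul, add_assoc]

theorem IsTest.lintegral_sphericalGaussian_le {φ : E → ℝ≥0∞} (hφ : IsTest φ) {s : ℝ≥0} (hs : s ≠ 0)
    {v : E} {b : ℝ} (hv : ‖v‖ ≤ b) {A : Set ℝ} (hA : IsLowerSet A)
    (h : ∫⁻ z, φ z ∂sphericalGaussian s 0 ≤ gaussianReal 0 (s ^ 2) A) :
    ∫⁻ z, φ z ∂sphericalGaussian s v ≤ gaussianReal (-b) (s ^ 2) A := by
  refine le_trans ?_ (gaussianReal_anti_of_isLowerSet hA _ (neg_le_neg hv))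
  rcases eq_or_ne v 0 with rfl | hv0
  · simpa using h
  let e : E := -(‖v‖⁻¹ • v)
  have hn : ‖v‖ ≠ 0 := norm_ne_zero_iff.2 hv0
  have he : ‖e‖ = 1 := by
    rw [norm_neg, norm_smul, norm_inv, norm_norm, inv_mul_cancel₀ hn]
  have hve : (-‖v‖) • e = v := by
    rw [smul_neg, neg_smul, neg_neg, smul_smul, mul_inv_cancel₀ hn, one_smul]
  obtain ⟨ψ, hψ, hφψ⟩ := hφ.exists_lintegral_sphericalGaussian_eq he s
  rw [← zero_smul ℝ e, hφψ 0] at h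
  rw [← hve, hφψ, hve]
  exact hψ.lintegral_gaussianReal_le (pow_ne_zero 2 hs) (neg_nonpos.2 (norm_nonneg v)) hA h

-- The previous lemma for the complementary test `1 - φ` and the lower set `-Aᶜ`.
theorem IsTest.le_lintegral_sphericalGaussian {φ : E → ℝ≥0∞} (hφ : IsTest φ) {s : ℝ≥0} (hs : s ≠ 0)
    {v : E} {b : ℝ} (hv : ‖v‖ ≤ b) {A : Set ℝ} (hA : IsLowerSet A)
    (h : gaussianReal 0 (s ^ 2) A ≤ ∫⁻ z, φ z ∂sphericalGaussian s 0) :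
    gaussianReal b (s ^ 2) A ≤ ∫⁻ z, φ z ∂sphericalGaussian s v := by
  have hAm : MeasurableSet A := hA.ordConnected.measurableSet
  have hneg : IsLowerSet ((- ·) ⁻¹' Aᶜ) := fun x y hyx hx hy => hx (hA (neg_le_neg hyx) hy)
  have h0 : ∫⁻ z, (1 - φ z) ∂sphericalGaussian s 0 ≤ gaussianReal 0 (s ^ 2) ((- ·) ⁻¹' Aᶜ) := by
    rw [hφ.lintegral_one_sub, ← neg_zero (G := ℝ), gaussianReal_neg_preimage_compl _ _ hAm]
    exact tsub_le_tsub_left h 1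
  have hb := hφ.one_sub.lintegral_sphericalGaussian_le hs hv hneg h0
  rw [gaussianReal_neg_preimage_compl _ _ hAm, hφ.lintegral_one_sub] at hb
  exact (ENNReal.sub_le_sub_iff_left prob_le_one ENNReal.one_ne_top).1 hb

theorem ApproxLE.sum_smul_sphericalGaussian {ι : Type*} [Fintype ι] {a δ : ℝ≥0∞} {p : ι → ℝ≥0∞}
    {b : ι → ℝ} {s : ℝ≥0} (hs : s ≠ 0) {v w : ι → E} (hv : ∀ i, ‖v i‖ ≤ b i)
    (hw : ∀ i, ‖w i‖ ≤ b i)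
    (h : ApproxLE a δ (∑ i, p i • gaussianReal (-b i) (s ^ 2))
      (∑ i, p i • gaussianReal (b i) (s ^ 2))) :
    ApproxLE a δ (∑ i, p i • sphericalGaussian s (v i)) (∑ i, p i • sphericalGaussian s (w i)) := by
  intro φ hφ
  obtain ⟨A, hA, hAφ⟩ := exists_isLowerSet_gaussianReal_eq 0 (pow_ne_zero 2 hs)
    (hφ.lintegral_le_one (sphericalGaussian s 0))
  have hA' := h.measure_le hA.ordConnected.measurableSet
  simp only [Measure.coe_finsetSum, Finset.sum_apply, Measure.smul_apply, smul_eq_mul] at hA'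
  simp only [lintegral_finsetSum_measure, lintegral_smul_measure, smul_eq_mul]
  calc ∑ i, p i * ∫⁻ z, φ z ∂sphericalGaussian s (v i)
      ≤ ∑ i, p i * gaussianReal (-b i) (s ^ 2) A := by
        gcongr with i
        exact hφ.lintegral_sphericalGaussian_le hs (hv i) hA hAφ.ge
    _ ≤ a * ∑ i, p i * gaussianReal (b i) (s ^ 2) A + δ := hA'
    _ ≤ a * ∑ i, p i * ∫⁻ z, φ z ∂sphericalGaussian s (w i) + δ := by
        gcongr with i
        exact hφ.le_lintegral_sphericalGaussian hs (hw i) hA hAφ.le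

theorem ApproxLE.sum_smul_sphericalGaussian_mul {ι : Type*} [Fintype ι] {a δ : ℝ≥0∞} {p : ι → ℝ≥0∞}
    {b : ι → ℝ} {s Δ : ℝ≥0} (hs : s ≠ 0) (hΔ : Δ ≠ 0) (m : E) {v w : ι → E}
    (hv : ∀ i, ‖v i - m‖ ≤ b i * Δ) (hw : ∀ i, ‖w i - m‖ ≤ b i * Δ)
    (h : ApproxLE a δ (∑ i, p i • gaussianReal (-b i) (s ^ 2))
      (∑ i, p i • gaussianReal (b i) (s ^ 2))) :
    ApproxLE a δ (∑ i, p i • sphericalGaussian (s * Δ) (v i))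
      (∑ i, p i • sphericalGaussian (s * Δ) (w i)) := by
  have hΔ' : (0 : ℝ) < Δ := NNReal.coe_pos.2 (pos_iff_ne_zero.2 hΔ)
  have hnorm : ∀ {u : ι → E}, (∀ i, ‖u i - m‖ ≤ b i * Δ) → ∀ i, ‖(Δ : ℝ)⁻¹ • (u i - m)‖ ≤ b i :=
    fun hu i => by
      rw [norm_smul, norm_inv, Real.norm_of_nonneg hΔ'.le, inv_mul_le_iff₀ hΔ', mul_comm]
      exact hu i
  have hg : Measurable fun z : E => m + (Δ : ℝ) • z := by fun_prop
  simpa only [Measure.map_finset_sum' hg.aemeasurable, Measure.map_smul,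
    sphericalGaussian_map_add_smul, smul_inv_smul₀ hΔ'.ne', add_sub_cancel] using
    (sum_smul_sphericalGaussian hs (hnorm hv) (hnorm hw) h).map hg

end SphericalGaussian

section DominatingPair

variable {r : ℝ} {lam : ℕ} {σ : ℝ≥0}

/-- The probability that, in `lam` independent trials with success probability `r`, the set of
successful trials is exactly `S`. -/
noncomputable def subsetWeight (r : ℝ) {lam : ℕ} (S : Finset (Fin lam)) : ℝ≥0∞ :=
  ENNReal.ofReal r ^ S.card * ENNReal.ofReal (1 - r) ^ (lam - S.card)

/-- The hockey stick divergence of the pair `P̄_r(lam)`, `Q̄_r(lam)` of Gaussian mixtures that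
dominates subsampling with inclusion probability `r`. -/
noncomputable def dominatingHockeyStick (lam : ℕ) (σ : ℝ≥0) (α r : ℝ) : ℝ≥0∞ :=
  hockeyStick α (MoG (fun i => -1 * evenMeans lam i) (binomialWeights lam r) σ)
    (MoG (evenMeans lam) (binomialWeights lam r) σ)

theorem sum_subsetWeight (h0 : 0 ≤ r) (h1 : r ≤ 1) (lam : ℕ) :
    ∑ S : Finset (Fin lam), subsetWeight r S = 1 := by
  have h := Fintype.sum_pow_mul_eq_add_pow (Fin lam) (ENNReal.ofReal r) (ENNReal.ofReal (1 - r))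
  rw [← ENNReal.ofReal_add h0 (sub_nonneg.2 h1), add_sub_cancel, ENNReal.ofReal_one, one_pow,
    Fintype.card_fin] at h
  exact h

theorem MoG_binomialWeights_eq_sum_subsetWeight (h0 : 0 ≤ r) (h1 : r ≤ 1) (μ : ℕ → ℝ) :
    MoG (fun i : Fin (lam + 1) => μ i) (binomialWeights lam r) σ =
      ∑ S : Finset (Fin lam), subsetWeight r S • gaussianReal (μ S.card) (σ ^ 2) := by
  have h := Finset.sum_powerset_apply_card (x := (Finset.univ : Finset (Fin lam))) fun k =>
    (ENNReal.ofReal r ^ k * ENNReal.ofReal (1 - r) ^ (lam - k)) • gaussianReal (μ k) (σ ^ 2)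
  rw [Finset.powerset_univ, Finset.card_univ, Fintype.card_fin, Finset.sum_range] at h
  refine Eq.trans (Finset.sum_congr rfl fun i _ => ?_) h.symm
  have h1' : 0 ≤ 1 - r := sub_nonneg.2 h1
  rw [binomialWeights, ENNReal.ofReal_mul (by positivity), ENNReal.ofReal_mul (by positivity),
    ENNReal.ofReal_pow h0, ENNReal.ofReal_pow h1', ENNReal.ofReal_natCast, mul_assoc, mul_smul,
    Nat.cast_smul_eq_nsmul]

theorem MoG_apply {K : ℕ} (μ p : Fin K → ℝ) (S : Set ℝ) :
    MoG μ p σ S = ∑ k, ENNReal.ofReal (p k) * gaussianReal (μ k) (σ ^ 2) S := by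
  simp only [MoG, Measure.coe_finsetSum, Finset.sum_apply, Measure.smul_apply, smul_eq_mul]

instance isFiniteMeasure_MoG {K : ℕ} (μ p : Fin K → ℝ) : IsFiniteMeasure (MoG μ p σ) where
  measure_univ_lt_top := by
    rw [MoG_apply]
    exact ENNReal.sum_lt_top.2 fun k _ => by simp

theorem MoG_absolutelyContinuous {K : ℕ} (μ ν p : Fin K → ℝ) (hσ : σ ≠ 0) :
    MoG μ p σ ≪ MoG ν p σ := by
  have hv : σ ^ 2 ≠ 0 := pow_ne_zero 2 hσ
  intro S hS
  simp only [MoG_apply, Finset.sum_eq_zero_iff, Finset.mem_univ, true_implies, mul_eq_zero] at hS ⊢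
  exact fun k => (hS k).imp_right fun h =>
    gaussianReal_absolutelyContinuous _ hv (gaussianReal_absolutelyContinuous' _ hv h)

theorem approxLE_sum_subsetWeight (h0 : 0 ≤ r) (h1 : r ≤ 1) (lam : ℕ) (hσ : σ ≠ 0) (α : ℝ) :
    ApproxLE (ENNReal.ofReal α) (dominatingHockeyStick lam σ α r)
      (∑ S : Finset (Fin lam), subsetWeight r S • gaussianReal (-(2 * S.card)) (σ ^ 2))
      (∑ S : Finset (Fin lam), subsetWeight r S • gaussianReal (2 * S.card) (σ ^ 2)) := by
  have hP : MoG (fun i => -1 * evenMeans lam i) (binomialWeights lam r) σ =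
      ∑ S : Finset (Fin lam), subsetWeight r S • gaussianReal (-(2 * S.card)) (σ ^ 2) := by
    simp only [neg_one_mul]
    exact MoG_binomialWeights_eq_sum_subsetWeight h0 h1 fun k => -(2 * (k : ℝ))
  have hQ : MoG (evenMeans lam) (binomialWeights lam r) σ =
      ∑ S : Finset (Fin lam), subsetWeight r S • gaussianReal (2 * S.card) (σ ^ 2) :=
    MoG_binomialWeights_eq_sum_subsetWeight h0 h1 fun k => 2 * (k : ℝ)
  rw [← hP, ← hQ]
  exact approxLE_hockeyStick (MoG_absolutelyContinuous _ _ _ hσ) α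

theorem one_le_add_dominatingHockeyStick (h0 : 0 ≤ r) (h1 : r ≤ 1) (lam : ℕ) (hσ : σ ≠ 0) (α : ℝ) :
    1 ≤ ENNReal.ofReal α + dominatingHockeyStick lam σ α r := by
  simpa [sum_subsetWeight h0 h1 lam] using
    (approxLE_sum_subsetWeight h0 h1 lam hσ α).measure_le MeasurableSet.univ

end DominatingPair

section Draws

section Piecewise

variable {J τ : Type*} [DecidableEq J]

theorem norm_piecewise_sub_le {E : Type*} [SeminormedAddCommGroup E] {F : (J → τ) → E} {c : ℝ}
    (hF : ∀ d j o, ‖F (Function.update d j o) - F d‖ ≤ c) (S : Finset J) (a b : J → τ) :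
    ‖F (S.piecewise a b) - F b‖ ≤ S.card * c := by
  induction S using Finset.induction_on with
  | empty => simp
  | insert j S hj ih =>
    rw [Finset.piecewise_insert, Finset.card_insert_of_notMem hj, Nat.cast_add_one, add_one_mul,
      add_comm]
    exact (norm_sub_le_norm_sub_add_norm_sub _ _ _).trans (add_le_add (hF _ _ _) ih)

variable {R M : Type*} [CommSemiring R] [AddCommMonoid M] [Module R M] [Fintype J] [Fintype τ]

theorem prod_mul_add_mul_eq_sum_piecewise (p q : R) (A B : J → R) :
    ∏ j, (p * A j + q * B j) =
      ∑ S : Finset J, p ^ S.card * q ^ Sᶜ.card * ∏ j, S.piecewise A B j := by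
  rw [Fintype.prod_add]
  refine Finset.sum_congr rfl fun S _ => ?_
  rw [Finset.prod_mul_distrib, Finset.prod_mul_distrib, Finset.prod_const, Finset.prod_const,
    Finset.prod_piecewise, Finset.univ_inter, ← Finset.compl_eq_univ_sdiff]
  ring

theorem sum_prod_eq_one {A : J → τ → R} (hA : ∀ j, ∑ o, A j o = 1) :
    ∑ d : J → τ, ∏ j, A j (d j) = 1 := by
  rw [← Fintype.prod_sum]
  exact Finset.prod_eq_one fun j _ => hA j

-- `(a, b) ↦ (S.piecewise a b, S.piecewise b a)` is an involution on pairs of families of draws.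
theorem sum_prod_smul_piecewise {A B : τ → R} (hA : ∑ o, A o = 1) (hB : ∑ o, B o = 1)
    (S : Finset J) (h : (J → τ) → M) :
    ∑ c : (J → τ) × (J → τ), ((∏ j, A (c.1 j)) * ∏ j, B (c.2 j)) • h (S.piecewise c.1 c.2) =
      ∑ d : J → τ, (∏ j, S.piecewise (fun j => A (d j)) (fun j => B (d j)) j) • h d := by
  let swap : (J → τ) × (J → τ) → (J → τ) × (J → τ) :=
    fun c => (S.piecewise c.1 c.2, S.piecewise c.2 c.1)
  have hswap : Function.Involutive swap := fun c => by
    simp [swap, Finset.piecewise_same]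
  have hunused : ∑ e : J → τ, ∏ j, S.piecewise (fun j => B (e j)) (fun j => A (e j)) j = 1 :=
    sum_prod_eq_one (A := fun j o => if j ∈ S then B o else A o) fun j => by
      split_ifs
      exacts [hB, hA]
  calc _ = ∑ c : (J → τ) × (J → τ),
        ((∏ j, S.piecewise (fun j => A (c.1 j)) (fun j => B (c.1 j)) j) *
          ∏ j, S.piecewise (fun j => B (c.2 j)) (fun j => A (c.2 j)) j) • h c.1 := by
        refine Fintype.sum_bijective swap hswap.bijective _ _ fun c => ?_
        congr 1
        simp only [← Finset.prod_mul_distrib]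
        refine Finset.prod_congr rfl fun j _ => ?_
        by_cases hj : j ∈ S <;> simp [swap, hj, mul_comm]
    _ = _ := by
        simp only [Fintype.sum_prod_type, mul_smul, ← Finset.smul_sum, ← Finset.sum_smul, hunused,
          one_smul]

theorem sum_prod_mul_add_mul_smul {A B : τ → R} (hA : ∑ o, A o = 1) (hB : ∑ o, B o = 1)
    (p q : R) (h : (J → τ) → M) :
    ∑ d : J → τ, (∏ j, (p * A (d j) + q * B (d j))) • h d =
      ∑ c : (J → τ) × (J → τ), ((∏ j, A (c.1 j)) * ∏ j, B (c.2 j)) •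
        ∑ S : Finset J, (p ^ S.card * q ^ Sᶜ.card) • h (S.piecewise c.1 c.2) := by
  simp only [prod_mul_add_mul_eq_sum_piecewise, Finset.sum_smul, Finset.smul_sum]
  rw [Finset.sum_comm, Finset.sum_comm (γ := (J → τ) × (J → τ))]
  refine Finset.sum_congr rfl fun S _ => ?_
  simp only [mul_smul (p ^ S.card * q ^ Sᶜ.card)]
  simp only [smul_comm (p ^ S.card * q ^ Sᶜ.card)]
  exact (sum_prod_smul_piecewise hA hB S fun d => (p ^ S.card * q ^ Sᶜ.card) • h d).symm

end Piecewise

section GroupWeight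

variable {ι : Type*} [DecidableEq ι]

/-- The weights of the uniform distribution on `G`, or of the point mass at the dummy draw `none` if
`G` is empty, so that they always sum to `1`. -/
noncomputable def groupWeight (G : Finset ι) : Option ι → ℝ≥0∞
  | none => if G = ∅ then 1 else 0
  | some i => if i ∈ G then (G.card : ℝ≥0∞)⁻¹ else 0

variable [Fintype ι]

theorem sum_groupWeight (G : Finset ι) : ∑ o, groupWeight G o = 1 := by
  rw [Fintype.sum_option]
  rcases G.eq_empty_or_nonempty with rfl | hG
  · simp [groupWeight]
  · simp only [groupWeight, hG.ne_empty, if_false, zero_add, Finset.sum_ite_mem, Finset.univ_inter,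
      Finset.sum_const, nsmul_eq_mul]
    exact ENNReal.mul_inv_cancel (by simpa using hG.ne_empty) (ENNReal.natCast_ne_top _)

theorem card_div_card_mul_groupWeight (G : Finset ι) (o : Option ι) :
    (G.card : ℝ≥0∞) / Fintype.card ι * groupWeight G o =
      o.elim 0 fun i => if i ∈ G then (Fintype.card ι : ℝ≥0∞)⁻¹ else 0 := by
  cases o with
  | none => by_cases hG : G = ∅ <;> simp [groupWeight, hG]
  | some i =>
    by_cases hi : i ∈ G
    · have hG : (G.card : ℝ≥0∞) ≠ 0 := by simpa using Finset.ne_empty_of_mem hi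
      simp only [groupWeight, hi, if_true, Option.elim_some]
      rw [ENNReal.div_eq_inv_mul, mul_assoc, ENNReal.mul_inv_cancel hG (ENNReal.natCast_ne_top _),
        mul_one]
    · simp [groupWeight, hi]

theorem mul_groupWeight_add_mul_groupWeight_compl (G : Finset ι) (o : Option ι) :
    (G.card : ℝ≥0∞) / Fintype.card ι * groupWeight G o +
        (Gᶜ.card : ℝ≥0∞) / Fintype.card ι * groupWeight Gᶜ o =
      o.elim 0 fun _ => (Fintype.card ι : ℝ≥0∞)⁻¹ := by
  rw [card_div_card_mul_groupWeight, card_div_card_mul_groupWeight]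
  cases o with
  | none => simp
  | some i => by_cases hi : i ∈ G <;> simp [hi]

theorem subsetWeight_card_div_card [Nonempty ι] (G : Finset ι) {lam : ℕ} (S : Finset (Fin lam)) :
    subsetWeight ((G.card : ℝ) / Fintype.card ι) S =
      ((G.card : ℝ≥0∞) / Fintype.card ι) ^ S.card *
        ((Gᶜ.card : ℝ≥0∞) / Fintype.card ι) ^ Sᶜ.card := by
  have hι : (0 : ℝ) < Fintype.card ι := Nat.cast_pos.2 Fintype.card_pos
  have hcompl : 1 - (G.card : ℝ) / Fintype.card ι = (Gᶜ.card : ℝ) / Fintype.card ι := by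
    rw [Finset.card_compl, Nat.cast_sub (Finset.card_le_univ G), sub_div, div_self hι.ne']
  simp only [subsetWeight, hcompl, ENNReal.ofReal_div_of_pos hι, ENNReal.ofReal_natCast,
    Finset.card_compl, Fintype.card_fin]

theorem uniformMixture_draws_eq_sum [Nonempty ι] (G : Finset ι) {lam : ℕ} {Ω : Type*}
    [MeasurableSpace Ω] (μ : (Fin lam → Option ι) → Measure Ω) :
    (uniformMixture fun d : Fin lam → ι => μ (some ∘ d)) =
      ∑ c : (Fin lam → Option ι) × (Fin lam → Option ι),
        ((∏ j, groupWeight G (c.1 j)) * ∏ j, groupWeight Gᶜ (c.2 j)) •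
          ∑ S : Finset (Fin lam), subsetWeight ((G.card : ℝ) / Fintype.card ι) S •
            μ (S.piecewise c.1 c.2) := by
  simp only [subsetWeight_card_div_card]
  rw [← sum_prod_mul_add_mul_smul (sum_groupWeight G) (sum_groupWeight Gᶜ), uniformMixture,
    Finset.smul_sum]
  simp only [mul_groupWeight_add_mul_groupWeight_compl]
  refine Fintype.sum_of_injective (some ∘ ·) (Option.some_injective ι).comp_left _ _
    (fun d hd => ?_) fun d => ?_
  · obtain ⟨j, hj⟩ : ∃ j, d j = none := by
      by_contra! h
      choose e he using fun j => Option.ne_none_iff_exists'.1 (h j)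
      exact hd ⟨e, funext fun j => (he j).symm⟩
    rw [Finset.prod_eq_zero (Finset.mem_univ j) (by rw [hj, Option.elim_none]), zero_smul]
  · simp [ENNReal.inv_pow]

end GroupWeight

theorem approxLE_uniformMixture_draws {ι E : Type*} [Fintype ι] [Nonempty ι] [NormedAddCommGroup E]
    [InnerProductSpace ℝ E] [FiniteDimensional ℝ E] [MeasurableSpace E] [BorelSpace E]
    (G : Finset ι) {lam : ℕ} {σ Δ : ℝ≥0} (hσ : σ ≠ 0) (hΔ : Δ ≠ 0) (α : ℝ)
    {F F' : (Fin lam → Option ι) → E}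
    (hFF' : ∀ d, (∀ j, ∀ i ∈ G, d j ≠ some i) → F d = F' d)
    (hF : ∀ d j o, ‖F (Function.update d j o) - F d‖ ≤ 2 * Δ)
    (hF' : ∀ d j o, ‖F' (Function.update d j o) - F' d‖ ≤ 2 * Δ) :
    ApproxLE (ENNReal.ofReal α)
      (dominatingHockeyStick lam σ α ((G.card : ℝ) / Fintype.card ι))
      (uniformMixture fun d : Fin lam → ι => sphericalGaussian (σ * Δ) (F (some ∘ d)))
      (uniformMixture fun d : Fin lam → ι => sphericalGaussian (σ * Δ) (F' (some ∘ d))) := by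
  classical
  have hr0 : 0 ≤ (G.card : ℝ) / Fintype.card ι := by positivity
  have hr1 : (G.card : ℝ) / Fintype.card ι ≤ 1 :=
    div_le_one_of_le₀ (Nat.cast_le.2 (Finset.card_le_univ G)) (Nat.cast_nonneg _)
  rw [uniformMixture_draws_eq_sum G fun d => sphericalGaussian (σ * Δ) (F d),
    uniformMixture_draws_eq_sum G fun d => sphericalGaussian (σ * Δ) (F' d)]
  refine ApproxLE.sum_smul ?_ fun c hc => ?_
  · simp only [Fintype.sum_prod_type]
    rw [← Fintype.sum_mul_sum, sum_prod_eq_one fun _ => sum_groupWeight G,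
      sum_prod_eq_one fun _ => sum_groupWeight Gᶜ, mul_one]
  -- No draw from the complement hits `G`, so it is a center common to `F` and `F'`.
  have hcenter : F c.2 = F' c.2 := by
    refine hFF' c.2 fun j i hi hj => right_ne_zero_of_mul hc ?_
    exact Finset.prod_eq_zero (Finset.mem_univ j) (by simp [hj, groupWeight, hi])
  have hv : ∀ S : Finset (Fin lam), ‖F (S.piecewise c.1 c.2) - F c.2‖ ≤ 2 * S.card * Δ :=
    fun S => (norm_piecewise_sub_le hF S c.1 c.2).trans_eq (by ring)
  have hw : ∀ S : Finset (Fin lam), ‖F' (S.piecewise c.1 c.2) - F c.2‖ ≤ 2 * S.card * Δ :=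
    fun S => by
      rw [hcenter]
      exact (norm_piecewise_sub_le hF' S c.1 c.2).trans_eq (by ring)
  exact ApproxLE.sum_smul_sphericalGaussian_mul hσ hΔ (F c.2) hv hw
    (approxLE_sum_subsetWeight hr0 hr1 lam hσ α)

end Draws

section WithReplacement

variable {A : Type*} {D : ℕ} {f : Multiset A → EuclideanSpace ℝ (Fin D)} {σ Δ : ℝ≥0}

theorem withReplacementMechanism_eq_uniformMixture (lam : ℕ)
    (f : Multiset A → EuclideanSpace ℝ (Fin D)) (σ Δ : ℝ≥0) (x : Finset A) :
    withReplacementMechanism lam f σ Δ x = uniformMixture fun draw : Fin lam → x =>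
      sphericalGaussian (σ * Δ)
        (f ((Finset.univ : Finset (Fin lam)).val.map fun j => (draw j : A))) := by
  simp only [withReplacementMechanism, isotropicGaussian_map_add]

theorem isProbabilityMeasure_withReplacementMechanism (lam : ℕ)
    (f : Multiset A → EuclideanSpace ℝ (Fin D)) (σ Δ : ℝ≥0) {x : Finset A} (hx : x.Nonempty) :
    IsProbabilityMeasure (withReplacementMechanism lam f σ Δ x) := by
  have := hx.to_subtype
  rw [withReplacementMechanism_eq_uniformMixture]
  exact isProbabilityMeasure_uniformMixture fun _ => inferInstance

theorem multiset_filterMap_congr {B : Type*} {s : Multiset A} {u v : A → Option B}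
    (h : ∀ a ∈ s, u a = v a) : s.filterMap u = s.filterMap v := by
  induction s using Quotient.inductionOn with
  | h l => exact congrArg _ (List.filterMap_congr h)

theorem SensitivityBound.norm_filterMap_update_sub_le (hf : SensitivityBound f Δ) {J : Type*}
    [Fintype J] [DecidableEq J] (d : J → Option A) (j : J) (o : Option A) :
    ‖f ((Finset.univ : Finset J).val.filterMap (Function.update d j o)) -
      f ((Finset.univ : Finset J).val.filterMap d)‖ ≤ 2 * Δ := by
  let rest : Finset J := Finset.univ.erase j
  have huniv : (Finset.univ : Finset J).val = j ::ₘ rest.val := by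
    rw [Finset.erase_val, Multiset.cons_erase (Finset.mem_univ_val j)]
  have hinsert : ∀ e : J → Option A,
      ‖f ((Finset.univ : Finset J).val.filterMap e) - f (rest.val.filterMap e)‖ ≤ Δ := by
    intro e
    rw [huniv]
    cases he : e j with
    | none => simp [Multiset.filterMap_cons_none _ _ he]
    | some a => simpa only [Multiset.filterMap_cons_some _ _ _ he] using hf _ a
  have hrest : rest.val.filterMap (Function.update d j o) = rest.val.filterMap d :=
    multiset_filterMap_congr fun i hi => Function.update_of_ne (Finset.ne_of_mem_erase hi) _ _
  have hd := hinsert d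
  have hupdate := hinsert (Function.update d j o)
  rw [hrest] at hupdate
  rw [norm_sub_rev] at hd
  rw [two_mul]
  exact (norm_sub_le_norm_sub_add_norm_sub _ _ _).trans (add_le_add hupdate hd)

variable [DecidableEq A] {k : ℕ} {x x' : Finset A}

theorem GroupSubstitutionNeighbor.exists_equiv (h : GroupSubstitutionNeighbor k x x') :
    ∃ (G : Finset x) (e : x ≃ x'), G.card = k ∧ ∀ a ∉ G, (e a : A) = a := by
  obtain ⟨g, g', hg, hg', hgk, hgk', hd⟩ := h
  have hcard : Fintype.card x = x'.card := by
    rw [Fintype.card_coe, ← Finset.card_sdiff_add_card_eq_card hg,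
      ← Finset.card_sdiff_add_card_eq_card hg', hd, hgk, hgk']
  let G : Finset x := Finset.univ.filter fun a => (a : A) ∈ g
  have hmaps : Gᶜ.image (Subtype.val : x → A) ⊆ x' := by
    intro a ha
    obtain ⟨b, hb, rfl⟩ := Finset.mem_image.1 ha
    have hbg : (b : A) ∈ x \ g := Finset.mem_sdiff.2 ⟨b.2, by simpa [G] using hb⟩
    exact (Finset.mem_sdiff.1 (hd ▸ hbg)).1
  obtain ⟨e, he⟩ := Finset.exists_equiv_extend_of_card_eq hcard hmaps
    Subtype.val_injective.injOn
  refine ⟨G, e, ?_, fun a ha => he a (Finset.mem_compl.2 ha)⟩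
  rw [← hgk, ← Finset.card_image_of_injective G Subtype.val_injective]
  congr 1
  ext a
  simpa [G] using fun ha => hg ha

theorem approxLE_withReplacementMechanism (hf : SensitivityBound f Δ) (hΔ : Δ ≠ 0) (hσ : σ ≠ 0)
    (α : ℝ) (lam : ℕ) (hx : x.Nonempty) (h : GroupSubstitutionNeighbor k x x') :
    ApproxLE (ENNReal.ofReal α) (dominatingHockeyStick lam σ α (k / x.card))
      (withReplacementMechanism lam f σ Δ x) (withReplacementMechanism lam f σ Δ x') := by
  obtain ⟨G, e, rfl, he⟩ := h.exists_equiv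
  have := hx.to_subtype
  let F : (x → A) → (Fin lam → Option x) → EuclideanSpace ℝ (Fin D) := fun u d =>
    f ((Finset.univ : Finset (Fin lam)).val.filterMap (Option.map u ∘ d))
  have hFF' : ∀ d : Fin lam → Option x, (∀ j, ∀ i ∈ G, d j ≠ some i) →
      F (↑) d = F (fun a => e a) d := by
    intro d hd
    refine congrArg f (multiset_filterMap_congr fun j _ => ?_)
    rw [Function.comp_apply, Function.comp_apply]
    cases hj : d j with
    | none => rfl
    | some a => rw [Option.map_some, Option.map_some, he a fun ha => hd j a ha hj]
  have hF : ∀ u d j o, ‖F u (Function.update d j o) - F u d‖ ≤ 2 * Δ := fun u d j o => by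
    simpa only [F, Function.comp_update] using
      hf.norm_filterMap_update_sub_le (Option.map u ∘ d) j _
  have hsome : ∀ (u : x → A) (d : Fin lam → x), F u (some ∘ d) =
      f ((Finset.univ : Finset (Fin lam)).val.map fun j => u (d j)) := fun u d =>
    congrArg f (congrFun (Multiset.filterMap_eq_map _) _)
  have hmain := approxLE_uniformMixture_draws G hσ hΔ α hFF' (hF _) (hF _)
  simp only [hsome, Fintype.card_coe] at hmain
  rwa [withReplacementMechanism_eq_uniformMixture, withReplacementMechanism_eq_uniformMixture,
    ← uniformMixture_comp_equiv (Equiv.piCongrRight fun _ : Fin lam => e)]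

end WithReplacement

section Finite

theorem norm_sum_update_sub_sum_le {J τ E : Type*} [Fintype J] [DecidableEq J]
    [SeminormedAddCommGroup E] {u : τ → E} {C : ℝ} (hu : ∀ o, ‖u o‖ ≤ C) (d : J → τ) (j : J)
    (o : τ) : ‖∑ i, u (Function.update d j o i) - ∑ i, u (d i)‖ ≤ 2 * C := by
  have hsum : ∑ i, u (Function.update d j o i) - ∑ i, u (d i) = u o - u (d j) := by
    rw [← Finset.sum_sub_distrib, Fintype.sum_eq_single j fun i hi => by
      rw [Function.update_of_ne hi, sub_self], Function.update_self]
  rw [hsum, two_mul]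
  exact norm_sub_le_of_le (hu _) (hu _)

theorem sum_funSplitAt_symm {B κ M : Type*} [Fintype B] [DecidableEq B] [AddCommMonoid M] (b : B)
    (k : κ) (ρ : {m // m ≠ b} → κ) (g : B → κ → M) :
    ∑ m, g m ((Equiv.funSplitAt b κ).symm (k, ρ) m) = g b k + ∑ m : {m // m ≠ b}, g m (ρ m) := by
  rw [Fintype.sum_eq_add_sum_subtype_ne _ b]
  congr 1
  · simp
  · exact Finset.sum_congr rfl fun m _ => by simp [m.2]

theorem exists_finset_card_eq_of_window {L LC LF w : ℕ} (hL : LC + LF + w ≤ L - LF + 1) (t : ℕ) :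
    ∃ G : Finset (Fin (L - LF + 1)), G.card = LC + LF + w ∧
      ∀ s ∉ G, (s : ℕ) + LF ≤ t ∨ LC + t + (w + 1) ≤ s := by
  let affected : Finset (Fin (L - LF + 1)) :=
    Finset.univ.filter fun s => t < s + LF ∧ (s : ℕ) < LC + t + (w + 1)
  have hsub : affected.map Fin.valEmbedding ⊆ Finset.Ico (t + 1 - LF) (LC + t + (w + 1)) := by
    intro s hs
    obtain ⟨s', hs', rfl⟩ := Finset.mem_map.1 hs
    have := (Finset.mem_filter.1 hs').2
    simp only [Fin.valEmbedding_apply, Finset.mem_Ico]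
    omega
  have hcard : affected.card ≤ LC + LF + w := by
    have := Finset.card_le_card hsub
    rw [Finset.card_map, Nat.card_Ico] at this
    omega
  obtain ⟨G, hG, hGcard⟩ := Finset.exists_superset_card_eq hcard (by simpa using hL)
  refine ⟨G, hGcard, fun s hs => ?_⟩
  by_contra! h
  exact hs (hG (by simp [affected, h]))

end Finite

section WindowGradient

variable {L LC LF D : ℕ} {O : Type*} {model : EuclideanSpace ℝ (Fin D) → (Fin LC → ℝ) → O}
  {loss : O → (Fin LF → ℝ) → ℝ}

theorem norm_clipGradient_le {C : ℝ≥0} (hC : C ≠ 0) (g : EuclideanSpace ℝ (Fin D)) :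
    ‖clipGradient C g‖ ≤ C := by
  have hmax : (0 : ℝ) < max 1 (‖g‖ / C) := lt_max_of_lt_left one_pos
  rw [clipGradient, norm_smul, norm_inv, Real.norm_of_nonneg hmax.le, inv_mul_le_iff₀ hmax,
    ← div_le_iff₀ (NNReal.coe_pos.2 (pos_iff_ne_zero.2 hC))]
  exact le_max_right _ _

theorem measurable_clipGradient (C : ℝ≥0) : Measurable (clipGradient (D := D) C) := by
  unfold clipGradient
  fun_prop

theorem measurable_gradient {E : Type*} [NormedAddCommGroup E] [InnerProductSpace ℝ E]
    [CompleteSpace E] [MeasurableSpace E] [BorelSpace E] (g : E → ℝ) : Measurable (gradient g) :=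
  (InnerProductSpace.toDual ℝ _).symm.continuous.measurable.comp (measurable_fderiv ℝ g)

theorem measurable_windowGradient (C : ℝ≥0) (a : Fin L → ℝ) (t : ℕ) :
    Measurable fun θ => windowGradient model loss C θ a t :=
  (measurable_clipGradient C).comp (measurable_gradient _)

theorem prependZeros_congr {a a' : Fin L → ℝ} {t w : ℕ}
    (h : ∀ s : Fin L, ¬(t ≤ s ∧ (s : ℕ) < t + w) → a s = a' s) {j : ℕ}
    (hj : j < LC + t ∨ LC + t + w ≤ j) : prependZeros LC a j = prependZeros LC a' j := by
  unfold prependZeros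
  split_ifs
  · exact h _ fun ht => by dsimp only at ht; omega
  · rfl

theorem windowGradient_congr {a a' : Fin L → ℝ} {t w : ℕ}
    (h : ∀ s : Fin L, ¬(t ≤ s ∧ (s : ℕ) < t + w) → a s = a' s) {s : ℕ}
    (hs : s + LF ≤ t ∨ LC + t + w ≤ s) (C : ℝ≥0) (θ : EuclideanSpace ℝ (Fin D)) :
    windowGradient model loss C θ a s = windowGradient model loss C θ a' s := by
  have hcontext : contextWindow LC a s = contextWindow LC a' s :=
    funext fun i => prependZeros_congr h (by omega)
  have hforecast : forecastWindow LC LF a s = forecastWindow LC LF a' s :=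
    funext fun i => prependZeros_congr h (by omega)
  rw [windowGradient, windowGradient, hcontext, hforecast]

theorem approxLE_uniformMixture_windowGradient {w : ℕ} (hL : LC + LF + w ≤ L - LF + 1) (lam : ℕ)
    {σ C : ℝ≥0} (hσ : σ ≠ 0) (hC : C ≠ 0) (α : ℝ) {a a' : Fin L → ℝ} {t : ℕ}
    (h : ∀ s : Fin L, ¬(t ≤ s ∧ (s : ℕ) < t + (w + 1)) → a s = a' s)
    (θ c : EuclideanSpace ℝ (Fin D)) :
    ApproxLE (ENNReal.ofReal α)
      (dominatingHockeyStick lam σ α ((LC + LF + w : ℕ) / (L - LF + 1 : ℕ)))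
      (uniformMixture fun d : Fin lam → Fin (L - LF + 1) =>
        sphericalGaussian (σ * C) (∑ j, windowGradient model loss C θ a (d j) + c))
      (uniformMixture fun d : Fin lam → Fin (L - LF + 1) =>
        sphericalGaussian (σ * C) (∑ j, windowGradient model loss C θ a' (d j) + c)) := by
  obtain ⟨G, hGcard, hG⟩ := exists_finset_card_eq_of_window hL t
  let u : (Fin L → ℝ) → Option (Fin (L - LF + 1)) → EuclideanSpace ℝ (Fin D) :=
    fun y o => o.elim 0 fun s => windowGradient model loss C θ y s
  let F : (Fin L → ℝ) → (Fin lam → Option (Fin (L - LF + 1))) → EuclideanSpace ℝ (Fin D) :=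
    fun y d => ∑ j, u y (d j) + c
  have hu : ∀ y o, ‖u y o‖ ≤ C := by
    rintro y (_ | s)
    · exact norm_zero.trans_le C.coe_nonneg
    · exact norm_clipGradient_le hC _
  have hF : ∀ y d j o, ‖F y (Function.update d j o) - F y d‖ ≤ 2 * C := fun y d j o => by
    rw [add_sub_add_right_eq_sub]
    exact norm_sum_update_sub_sum_le (hu y) d j o
  have hFF' : ∀ d : Fin lam → Option (Fin (L - LF + 1)), (∀ j, ∀ i ∈ G, d j ≠ some i) →
      F a d = F a' d := by
    intro d hd
    refine congrArg (· + c) (Finset.sum_congr rfl fun j _ => ?_)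
    cases hj : d j with
    | none => rfl
    | some s => exact windowGradient_congr h (hG s fun hs => hd j s hs hj) C θ
  have hmain := approxLE_uniformMixture_draws G hσ hC α hFF' (hF a) (hF a')
  rw [hGcard, Fintype.card_fin] at hmain
  exact hmain

end WindowGradient

section Training

variable {N L LC LF D : ℕ} {O : Type*} {model : EuclideanSpace ℝ (Fin D) → (Fin LC → ℝ) → O}
  {loss : O → (Fin LF → ℝ) → ℝ} {lam Lam : ℕ} {η : ℝ} {σ C : ℝ≥0} {θ₀ : EuclideanSpace ℝ (Fin D)}
  {x x' : Fin N → Fin L → ℝ} {n : Fin N}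

theorem noisyGradientLaw_eq_map (x : Fin N → Fin L → ℝ) (b : ℕ) (θ : EuclideanSpace ℝ (Fin D)) :
    noisyGradientLaw lam Lam model loss σ C x b θ =
      (uniformMixture fun start : topLevelBatch N lam Lam b → Fin lam → Fin (L - LF + 1) =>
        sphericalGaussian (σ * C) (∑ m : topLevelBatch N lam Lam b, ∑ j,
          windowGradient model loss C θ (x m) (start m j))).map ((Lam : ℝ)⁻¹ • ·) := by
  rw [map_uniformMixture _ (measurable_const_smul _), noisyGradientLaw]
  congr 1 with start : 1
  rw [← isotropicGaussian_map_add, Measure.map_map (by fun_prop) (by fun_prop)]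
  rfl

instance isProbabilityMeasure_noisyGradientLaw (b : ℕ) (θ : EuclideanSpace ℝ (Fin D)) :
    IsProbabilityMeasure (noisyGradientLaw lam Lam model loss σ C x b θ) := by
  rw [noisyGradientLaw_eq_map]
  have := isProbabilityMeasure_uniformMixture
    (μ := fun start : topLevelBatch N lam Lam b → Fin lam → Fin (L - LF + 1) =>
      sphericalGaussian (σ * C) (∑ m : topLevelBatch N lam Lam b, ∑ j,
        windowGradient model loss C θ (x m) (start m j))) fun _ => inferInstance
  exact Measure.isProbabilityMeasure_map (by fun_prop)

theorem measurable_noisyGradientLaw (b : ℕ) :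
    Measurable (noisyGradientLaw lam Lam model loss σ C x b) := by
  simp only [funext (noisyGradientLaw_eq_map x b)]
  refine (Measure.measurable_map _ (measurable_const_smul _)).comp
    (measurable_uniformMixture fun start => (measurable_sphericalGaussian _).comp ?_)
  exact Finset.measurable_sum _ fun m _ => Finset.measurable_sum _ fun j _ =>
    measurable_windowGradient C (x m) (start m j)

theorem noisyGradientLaw_congr (hx : ∀ m, m ≠ n → x m = x' m) {b : ℕ}
    (hb : n ∉ topLevelBatch N lam Lam b) :
    noisyGradientLaw lam Lam model loss σ C x b = noisyGradientLaw lam Lam model loss σ C x' b := by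
  have hbatch : ∀ m : topLevelBatch N lam Lam b, x m = x' m := fun m =>
    hx m fun h => hb (h ▸ m.2)
  funext θ
  simp only [noisyGradientLaw, hbatch]

theorem notMem_topLevelBatch_of_lt {b k : ℕ} (hn : n ∈ topLevelBatch N lam Lam k) (hb : b < k) :
    n ∉ topLevelBatch N lam Lam b := by
  intro h
  have hge := (Finset.mem_filter.1 hn).2.1
  have hlt := (Finset.mem_filter.1 h).2.2
  exact absurd (hge.trans_lt hlt) (Nat.mul_le_mul_right _ hb).not_gt

theorem approxLE_noisyGradientLaw {w : ℕ} (hL : LC + LF + w ≤ L - LF + 1) (hσ : σ ≠ 0) (hC : C ≠ 0)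
    (α : ℝ) (hx : ∀ m, m ≠ n → x m = x' m) {t : ℕ}
    (hxn : ∀ s : Fin L, ¬(t ≤ s ∧ (s : ℕ) < t + (w + 1)) → x n s = x' n s) {b : ℕ}
    (hn : n ∈ topLevelBatch N lam Lam b) (θ : EuclideanSpace ℝ (Fin D)) :
    ApproxLE (ENNReal.ofReal α)
      (dominatingHockeyStick lam σ α ((LC + LF + w : ℕ) / (L - LF + 1 : ℕ)))
      (noisyGradientLaw lam Lam model loss σ C x b θ)
      (noisyGradientLaw lam Lam model loss σ C x' b θ) := by
  let n₀ : topLevelBatch N lam Lam b := ⟨n, hn⟩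
  have hother : ∀ m : {m // m ≠ n₀}, x m.1 = x' m.1 := fun m =>
    hx _ fun h => m.2 (Subtype.ext h)
  rw [noisyGradientLaw_eq_map, noisyGradientLaw_eq_map]
  refine ApproxLE.map ?_ (measurable_const_smul _)
  rw [uniformMixture_pi n₀, uniformMixture_pi n₀]
  refine ApproxLE.uniformMixture fun ρ => ?_
  have hsplit : ∀ (y : Fin N → Fin L → ℝ) (d : Fin lam → Fin (L - LF + 1)),
      ∑ m : topLevelBatch N lam Lam b, ∑ j, windowGradient model loss C θ (y m)
          ((Equiv.funSplitAt n₀ (Fin lam → Fin (L - LF + 1))).symm (d, ρ) m j) =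
        ∑ j, windowGradient model loss C θ (y n) (d j) +
          ∑ m : {m // m ≠ n₀}, ∑ j, windowGradient model loss C θ (y m.1) (ρ m j) := fun y d =>
    sum_funSplitAt_symm n₀ d ρ fun m e => ∑ j, windowGradient model loss C θ (y m) (e j)
  simp only [hsplit, hother]
  exact approxLE_uniformMixture_windowGradient hL lam hσ hC α hxn θ _

theorem measurable_snoc {E : Type*} [MeasurableSpace E] (k : ℕ) :
    Measurable fun p : (Fin k → E) × E =>
      (Fin.snoc (α := fun _ => E) p.1 p.2 : Fin (k + 1) → E) := by
  refine measurable_pi_lambda _ (Fin.lastCases ?_ fun i => ?_)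
  · simpa only [Fin.snoc_last] using measurable_snd
  · simpa only [Fin.snoc_castSucc, Function.comp_def] using
      (measurable_pi_apply i).comp measurable_fst

theorem measurable_map_snoc {E : Type*} [MeasurableSpace E] {k : ℕ} {ν : (Fin k → E) → Measure E}
    (hν : Measurable ν) [∀ h, IsProbabilityMeasure (ν h)] :
    Measurable fun h => (ν h).map fun g => (Fin.snoc (α := fun _ => E) h g : Fin (k + 1) → E) := by
  let κ : Kernel (Fin k → E) E := ⟨ν, hν⟩
  have : IsMarkovKernel κ := ⟨‹_›⟩
  convert ((Kernel.id ×ₖ κ).map fun p => Fin.snoc (α := fun _ => E) p.1 p.2).measurable using 2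
    with h
  rw [Kernel.map_apply _ (measurable_snoc k), Kernel.prod_apply, Kernel.id_apply,
    Measure.dirac_prod, Measure.map_map (measurable_snoc k) measurable_prodMk_left]
  rfl

/-- Training step `k` as a Markov kernel, which appends the noisy gradient of this step to the
history of the `k` noisy gradients released before. -/
noncomputable def stepKernel (lam Lam : ℕ) (model : EuclideanSpace ℝ (Fin D) → (Fin LC → ℝ) → O)
    (loss : O → (Fin LF → ℝ) → ℝ) (η : ℝ) (σ C : ℝ≥0) (θ₀ : EuclideanSpace ℝ (Fin D))
    (x : Fin N → Fin L → ℝ) (k : ℕ) :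
    Kernel (Fin k → EuclideanSpace ℝ (Fin D)) (Fin (k + 1) → EuclideanSpace ℝ (Fin D)) where
  toFun h := (noisyGradientLaw lam Lam model loss σ C x k (θ₀ - η • ∑ i, h i)).map fun g =>
    Fin.snoc (α := fun _ => EuclideanSpace ℝ (Fin D)) h g
  measurable' := measurable_map_snoc ((measurable_noisyGradientLaw k).comp (by fun_prop))

instance isMarkovKernel_stepKernel (k : ℕ) :
    IsMarkovKernel (stepKernel lam Lam model loss η σ C θ₀ x k) where
  isProbabilityMeasure _ := Measure.isProbabilityMeasure_map
    ((measurable_snoc k).comp measurable_prodMk_left).aemeasurable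

theorem trainingLaw_succ (k : ℕ) :
    trainingLaw lam Lam model loss η σ C θ₀ x (k + 1) =
      (trainingLaw lam Lam model loss η σ C θ₀ x k).bind
        (stepKernel lam Lam model loss η σ C θ₀ x k) :=
  rfl

instance isProbabilityMeasure_trainingLaw (k : ℕ) :
    IsProbabilityMeasure (trainingLaw lam Lam model loss η σ C θ₀ x k) := by
  induction k with
  | zero => exact Measure.dirac.isProbabilityMeasure
  | succ k ih =>
    rw [trainingLaw_succ]
    infer_instance

theorem stepKernel_congr (hx : ∀ m, m ≠ n → x m = x' m) {k : ℕ}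
    (hk : n ∉ topLevelBatch N lam Lam k) :
    stepKernel lam Lam model loss η σ C θ₀ x k = stepKernel lam Lam model loss η σ C θ₀ x' k :=
  Kernel.ext fun _ => congrArg (Measure.map _) (congrFun (noisyGradientLaw_congr hx hk) _)

theorem trainingLaw_congr (hx : ∀ m, m ≠ n → x m = x' m) {k : ℕ}
    (hk : ∀ b < k, n ∉ topLevelBatch N lam Lam b) :
    trainingLaw lam Lam model loss η σ C θ₀ x k =
      trainingLaw lam Lam model loss η σ C θ₀ x' k := by
  induction k with
  | zero => rfl
  | succ k ih =>
    rw [trainingLaw_succ, trainingLaw_succ, ih fun b hb => hk b (hb.trans k.lt_succ_self),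
      stepKernel_congr hx (hk k k.lt_succ_self)]

theorem approxLE_trainingLaw {w : ℕ} (hL : LC + LF + w ≤ L - LF + 1) (hσ : σ ≠ 0) (hC : C ≠ 0)
    (α : ℝ) (hx : ∀ m, m ≠ n → x m = x' m) {t : ℕ}
    (hxn : ∀ s : Fin L, ¬(t ≤ s ∧ (s : ℕ) < t + (w + 1)) → x n s = x' n s) (k : ℕ) :
    ApproxLE (ENNReal.ofReal α)
      (dominatingHockeyStick lam σ α ((LC + LF + w : ℕ) / (L - LF + 1 : ℕ)))
      (trainingLaw lam Lam model loss η σ C θ₀ x k)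
      (trainingLaw lam Lam model loss η σ C θ₀ x' k) := by
  induction k with
  | zero =>
    refine ApproxLE.refl _ (one_le_add_dominatingHockeyStick (by positivity) ?_ lam hσ α)
    rw [div_le_one (by positivity)]
    exact_mod_cast hL
  | succ k ih =>
    rw [trainingLaw_succ, trainingLaw_succ]
    by_cases hn : n ∈ topLevelBatch N lam Lam k
    · rw [trainingLaw_congr hx fun b hb => notMem_topLevelBatch_of_lt hn hb]
      refine ApproxLE.bind _ fun h =>
        ApproxLE.map ?_ ((measurable_snoc k).comp measurable_prodMk_left)
      exact approxLE_noisyGradientLaw hL hσ hC α hx hxn hn _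
    · rw [stepKernel_congr hx hn]
      exact ih.bind_right _

end Training

section PrivacyProfile

theorem privacyProfile_epochMechanism_le {N L LC LF w D : ℕ} {O : Type*} {lam Lam : ℕ}
    {model : EuclideanSpace ℝ (Fin D) → (Fin LC → ℝ) → O} {loss : O → (Fin LF → ℝ) → ℝ} {η : ℝ}
    {σ C : ℝ≥0} {θ₀ : EuclideanSpace ℝ (Fin D)} (hL : (LC : ℝ) + LF + w ≤ L - LF + 1) (hσ : σ ≠ 0)
    (hC : C ≠ 0) {α : ℝ} (hα : 0 ≤ α) :
    privacyProfile (EventNeighbor (N := N) (L := L) (w + 1))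
        (epochMechanism lam Lam model loss η σ C θ₀) α ≤
      dominatingHockeyStick lam σ α (((LC : ℝ) + LF + w) / (L - LF + 1)) := by
  have hLF : LF ≤ L := by
    have hL' : LC + LF + w + LF ≤ L + 1 := by
      exact_mod_cast (by linarith : (LC : ℝ) + LF + w + LF ≤ L + 1)
    omega
  have hstarts : (L : ℝ) - LF + 1 = (L - LF + 1 : ℕ) := by push_cast [hLF]; rfl
  have hhits : (LC : ℝ) + LF + w = (LC + LF + w : ℕ) := by push_cast; rfl
  rw [hstarts, hhits] at hL ⊢
  refine iSup_le fun x => iSup_le fun x' => iSup_le fun ⟨n, hx, _, t, hxn⟩ => ?_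
  rw [epochMechanism, epochMechanism]
  exact (approxLE_trainingLaw (mod_cast hL) hσ hC α hx hxn _).hockeyStick_le hα

theorem privacyProfile_withReplacementMechanism_le {A : Type*} [DecidableEq A] {D T k : ℕ}
    {f : Multiset A → EuclideanSpace ℝ (Fin D)} {σ Δ : ℝ≥0} (lam : ℕ) (hT : T ≠ 0) (hΔ : Δ ≠ 0)
    (hσ : σ ≠ 0) (hf : SensitivityBound f Δ) {α : ℝ} (hα : 0 ≤ α) :
    privacyProfile
        (fun x x' : Finset A => x.card = T ∧ x'.card = T ∧ GroupSubstitutionNeighbor k x x')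
        (withReplacementMechanism lam f σ Δ) α ≤
      dominatingHockeyStick lam σ α (k / T) := by
  refine iSup_le fun x => iSup_le fun x' => iSup_le fun ⟨hx, hx', h⟩ => ?_
  have hne : x.Nonempty := Finset.card_ne_zero.1 (hx ▸ hT)
  have hne' : x'.Nonempty := Finset.card_ne_zero.1 (hx' ▸ hT)
  have := isProbabilityMeasure_withReplacementMechanism lam f σ Δ hne'
  rw [← hx]
  exact (approxLE_withReplacementMechanism hf hΔ hσ α lam hne h).hockeyStick_le hα

end PrivacyProfile

theorem mainTheorem8_general (lam : ℕ) (σ : ℝ≥0) (hσ : 0 < σ) (α : ℝ) (hα : 0 ≤ α) :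
    (∀ (w N L LC LF Lam D : ℕ) (O : Type*)
        (model : EuclideanSpace ℝ (Fin D) → (Fin LC → ℝ) → O) (loss : O → (Fin LF → ℝ) → ℝ)
        (η : ℝ) (C : ℝ≥0) (θ₀ : EuclideanSpace ℝ (Fin D)) (r : ℝ),
        1 ≤ Lam → 0 < C →
        (LC : ℝ) + LF + w ≤ L - LF + 1 →
        r = ((LC : ℝ) + LF + w) / (L - LF + 1) →
        privacyProfile (EventNeighbor (N := N) (L := L) (w + 1))
            (epochMechanism lam Lam model loss η σ C θ₀) α ≤
          hockeyStick α
            (MoG (fun i => -1 * evenMeans lam i) (binomialWeights lam r) σ)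
            (MoG (evenMeans lam) (binomialWeights lam r) σ)) ∧
    (∀ (A : Type*) [DecidableEq A] (D T k : ℕ)
        (f : Multiset A → EuclideanSpace ℝ (Fin D)) (Δ : ℝ≥0) (r : ℝ),
        1 ≤ T → 0 < Δ → SensitivityBound f Δ →
        r = (k : ℝ) / T →
        privacyProfile
            (fun x x' : Finset A =>
              x.card = T ∧ x'.card = T ∧ GroupSubstitutionNeighbor k x x')
            (withReplacementMechanism lam f σ Δ) α ≤
          hockeyStick α
            (MoG (fun i => -1 * evenMeans lam i) (binomialWeights lam r) σ)
            (MoG (evenMeans lam) (binomialWeights lam r) σ)) := by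
  refine ⟨?_, ?_⟩
  · rintro w N L LC LF Lam D O model loss η C θ₀ _ - hC hL rfl
    exact privacyProfile_epochMechanism_le hL hσ.ne' hC.ne' hα
  · rintro A _ D T k f Δ _ hT hΔ hf rfl
    exact privacyProfile_withReplacementMechanism_le lam (Nat.one_le_iff_ne_zero.1 hT) hΔ.ne' hσ.ne'
      hf hα

theorem mainTheorem8 (lam : ℕ) (hlam : 1 ≤ lam) (σ : ℝ≥0) (hσ : 0 < σ) (α : ℝ) (hα : 0 ≤ α) :
    -- per-epoch privacy profile of bi-level subsampled training
    (∀ (N L LC LF Lam D : ℕ) (O : Type*)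
        (model : EuclideanSpace ℝ (Fin D) → (Fin LC → ℝ) → O) (loss : O → (Fin LF → ℝ) → ℝ)
        (η : ℝ) (C : ℝ≥0) (θ₀ : EuclideanSpace ℝ (Fin D)) (r : ℝ),
        1 ≤ Lam → 0 < C →
        (LC : ℝ) + LF ≤ L - LF + 1 →
        r = ((LC : ℝ) + LF) / (L - LF + 1) →
        privacyProfile (EventNeighbor (N := N) (L := L) 1)
            (epochMechanism lam Lam model loss η σ C θ₀) α ≤
          hockeyStick α
            (MoG (fun i => -1 * evenMeans lam i) (binomialWeights lam r) σ)
            (MoG (evenMeans lam) (binomialWeights lam r) σ)) ∧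
    -- group privacy of sampling with replacement under substitution
    (∀ (A : Type*) [DecidableEq A] (D T k : ℕ)
        (f : Multiset A → EuclideanSpace ℝ (Fin D)) (Δ : ℝ≥0) (r : ℝ),
        1 ≤ T → 0 < Δ → SensitivityBound f Δ →
        r = (k : ℝ) / T →
        privacyProfile
            (fun x x' : Finset A =>
              x.card = T ∧ x'.card = T ∧ GroupSubstitutionNeighbor k x x')
            (withReplacementMechanism lam f σ Δ) α ≤
          hockeyStick α
            (MoG (fun i => -1 * evenMeans lam i) (binomialWeights lam r) σ)
            (MoG (evenMeans lam) (binomialWeights lam r) σ)) := by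
  exact (mainTheorem8_general lam σ hσ α hα).imp_left fun h => by simpa using h 0
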